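/- Let $\Bbbk$ be a field, let $n\ge 0$, and let $Q$ be the straight quiver $1\to 2\to\cdots\to n$ of type $\mathbb{A}_n$. For $0\le i<j\le n$ let $M_{i,j}$ be the indecomposable representation of $Q$ with support $\{i+1,\dots,j\}$. *Exceptional collections.* A finite-dimensional representation $V$ of $Q$ is exceptional if $\mathrm{End}(V)$ is a division ring and $\mathrm{Ext}^d(V,V)=0$ for all $d\ge1$. A (complete) exceptional sequence is a sequence $(V_1,\dots,V_n)$ of exceptional representations with $\mathrm{Hom}(V_i,V_j)=0=\mathrm{Ext}^1(V_i,V_j)$ for all $j<i$. A (complete) exceptional collection is a set of isomorphism classes of representations that can be ordered into such a sequence. The term $V_i$ is relatively injective in $(V_1,\dots,V_n)$ if it is an injective object of the full subcategory of all finite-dimensional representations $W$ with $\mathrm{Hom}(W,V_j)=0=\mathrm{Ext}^1(W,V_j)$ for all $j<i$. *The labelled ternary tree.* The strand diagram of a collection $E$ is the graph on $\{0,\dots,n\}$ with an edge (strand) $c(i,j)$ for each $M_{i,j}\in E$. A strand $c(i,j)$, $i<j$, is oriented to the right if $i$ is closer to $0$ than $j$ in this graph, and to the left if $j$ is closer to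 $0$ than $i$. The root $R$ of the tree of $E$ is the strand $c(0,k)$ of the diagram with $k$ maximal. If a node $X=c(i,j)$ is oriented to the right, then its children are $Xa=c(i,x)$ with $x<j$ maximal, $Xb=c(y,j)$ with $y>i$ minimal, and $Xc=c(j,z)$ with $z$ maximal. If $X$ is oriented to the left, then they are $Xa=c(x,j)$ with $x>i$ minimal, $Xb=c(i,y)$ with $y<j$ maximal, and $Xc=c(z,i)$ with $z$ minimal. Here all strands are taken in the diagram; whenever no such strand exists (for a child, or for the root), there is a leaf in its place. Each node is labelled by its strand $c(i,j)$, that is, by the object $M_{i,j}$. The address of a vertex (node or leaf) is the word in $a<b<c$ that leads to it from the root, the root having the empty word. *Lattice paths.* A lattice path of height $n$ is a path from $(0,0)$ to $(2n+1,n)$ made of unit steps up or to the right, all of whose lattice points other than the last one satisfy $x\le 2y$. **Theorem.** Every exceptional collection $E$ has a unique labelled ternary tree $T(E)$ as above, with $2n+1$ leaves, and taking the underlying unlabelled tree of $T(E)$ is a bijection from the exceptional collections to the rooted ternary trees with $n$ nodes. List the vertices of $T(E)$ in lexicographic order of their addresses (so the root comes first), and read each node as a step up and each leaf as a step to the right.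 The resulting path $\Phi(E)$ is a lattice path of height $n$, and $\Phi$ is a bijection from the exceptional collections to the lattice paths of height $n$. Sending a vertical edge of $\Phi(E)$ to the object that labels the corresponding node is a bijection from the $n$ vertical edges of $\Phi(E)$ to the objects of $E$. Finally, for every ordering of $E$ into an exceptional sequence, an object of $E$ is relatively injective in this sequence if and only if the first coordinate of its vertical edge is even. -/

import Mathlib

open CategoryTheory

universe u

namespace StraightA

/-! ### Representations of the straight quiver `1 → 2 → ⋯ → n` -/

/-- Finite-dimensional representations over `k` of the quiver `1 → 2 → ⋯ → n`.  Vertex `v` is the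
element `v - 1` of `Fin n`.  There is exactly one path `v → w` when `v ≤ w` and none otherwise, so
the path category of the quiver is the linear order `Fin n`, and a representation is a functor from
it to finite-dimensional vector spaces. -/
abbrev QuiverRep (k : Type u) [Field k] (n : ℕ) : Type (u + 1) := Fin n ⥤ FGModuleCat.{u} k

/-- `Ext^d(V, W) = 0` in the abelian category of finite-dimensional representations. -/
def ExtVanishes {k : Type u} [Field k] {n : ℕ} (d : ℕ) (V W : QuiverRep k n) : Prop :=
  letI := HasExt.standard (QuiverRep k n)
  Subsingleton (Abelian.Ext V W d)

/-- `Hom(V, W) = 0` and `Ext^1(V, W) = 0`. -/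
def HomExtVanish {k : Type u} [Field k] {n : ℕ} (V W : QuiverRep k n) : Prop :=
  (∀ f : V ⟶ W, f = 0) ∧ ExtVanishes 1 V W

/-- `V` is exceptional: its endomorphism ring is a division ring and `Ext^d(V, V) = 0` for all
`d ≥ 1`. -/
structure IsExceptional {k : Type u} [Field k] {n : ℕ} (V : QuiverRep k n) : Prop where
  nontrivial_end : Nontrivial (End V)
  isUnit_of_ne_zero : ∀ f : End V, f ≠ 0 → IsUnit f
  ext_self : ∀ d : ℕ, 1 ≤ d → ExtVanishes d V V

/-- A complete exceptional sequence `(V_1, …, V_n)`: each term is exceptional, and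
`Hom(V_i, V_j) = 0 = Ext(V_i, V_j)` for `j < i`. -/
structure IsExceptionalSequence {k : Type u} [Field k] {n : ℕ} (V : Fin n → QuiverRep k n) : Prop where
  exceptional : ∀ i, IsExceptional (V i)
  vanish : ∀ i j, j < i → HomExtVanish (V i) (V j)

/-- The left perpendicular category `^⊥(V_0 ⊕ ⋯ ⊕ V_{i-1})` of the terms before the `i`-th one:
all `W` with `Hom(W, V_j) = 0 = Ext(W, V_j)` for every `j < i`. -/
def leftPerp {k : Type u} [Field k] {n : ℕ} (V : Fin n → QuiverRep k n) (i : Fin n) :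
    ObjectProperty (QuiverRep k n) :=
  fun W => ∀ j, j < i → HomExtVanish W (V j)

/-- The `i`-th term is relatively injective in the sequence `V`: it is an injective object of the
left perpendicular category of the terms before it. -/
def IsRelativelyInjective {k : Type u} [Field k] {n : ℕ} (V : Fin n → QuiverRep k n) (i : Fin n) :
    Prop :=
  ∃ h : leftPerp V i (V i), Injective (⟨V i, h⟩ : (leftPerp V i).FullSubcategory)

/-- Isomorphism classes of representations. -/
abbrev IsoClass (k : Type u) [Field k] (n : ℕ) : Type (u + 1) :=
  Quotient (isIsomorphicSetoid (QuiverRep k n))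

/-- The isomorphism class of a representation. -/
def isoClass {k : Type u} [Field k] {n : ℕ} (V : QuiverRep k n) : IsoClass k n :=
  Quotient.mk (isIsomorphicSetoid (QuiverRep k n)) V

/-- `V` is a complete exceptional sequence whose underlying set of isomorphism classes is `E`. -/
def IsOrderingOf {k : Type u} [Field k] {n : ℕ} (V : Fin n → QuiverRep k n) (E : Set (IsoClass k n)) :
    Prop :=
  IsExceptionalSequence V ∧ E = Set.range fun i => isoClass (V i)

/-- Complete exceptional collections: sets of (isomorphism classes of) representations that can be
ordered into a complete exceptional sequence. -/
def ExceptionalCollection (k : Type u) [Field k] (n : ℕ) : Type (u + 1) :=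
  {E : Set (IsoClass k n) // ∃ V : Fin n → QuiverRep k n, IsOrderingOf V E}

/-! ### Strands and the modules `M_{i,j}` -/

/-- The strands `c(i, j)` with `0 ≤ i < j ≤ n`. -/
@[ext]
structure Strand (n : ℕ) where
  i : Fin (n + 1)
  j : Fin (n + 1)
  lt : i < j

/-- Strands are ordered by inclusion of supports: `(i, j] ⊆ (p, q]`. -/
instance {n : ℕ} : LE (Strand n) := ⟨fun s t => t.i ≤ s.i ∧ s.j ≤ t.j⟩

/-- The vertex `v + 1` of the quiver lies in the support `(i, j]` of `c(i, j)`. -/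
def Strand.Supports {n : ℕ} (s : Strand n) (v : Fin n) : Prop :=
  (s.i : ℕ) < (v : ℕ) + 1 ∧ (v : ℕ) + 1 ≤ (s.j : ℕ)

open Classical in
/-- The structure map `M_{i,j}(v) → M_{i,j}(w)`: the identity of `k` if both vertices lie in the
support, and `0` otherwise. -/
noncomputable def intervalMap (k : Type u) [Field k] {n : ℕ} (s : Strand n) (v w : Fin n) :
    (PLift (s.Supports v) → k) →ₗ[k] (PLift (s.Supports w) → k) where
  toFun f _ := if h : s.Supports v then f ⟨h⟩ else 0
  map_add' f g := by
    funext _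
    by_cases h : s.Supports v <;> simp [h]
  map_smul' c f := by
    funext _
    by_cases h : s.Supports v <;> simp [h]

/-- The representation `M_{i,j}`: it is `k` at the vertices in `(i, j]` and `0` at the others (the
space of functions from a one-point, respectively empty, type to `k`), and its structure maps are
the identity between vertices of the support and `0` otherwise. -/
noncomputable def intervalModule (k : Type u) [Field k] {n : ℕ} (s : Strand n) : QuiverRep k n where
  obj v := FGModuleCat.of k (PLift (s.Supports v) → k)
  map {v w} _ := FGModuleCat.ofHom (intervalMap k s v w)
  map_id v := by
    apply FGModuleCat.hom_ext
    apply LinearMap.ext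
    intro f
    funext h
    change intervalMap k s v v f h = f h
    simp [intervalMap, h.down]
  map_comp {v w x} a b := by
    apply FGModuleCat.hom_ext
    apply LinearMap.ext
    intro f
    funext h
    change intervalMap k s v x f h = intervalMap k s w x (intervalMap k s v w f) h
    have hx : s.Supports x := h.down
    have hvw : (v : ℕ) ≤ (w : ℕ) := leOfHom a
    have hwx : (w : ℕ) ≤ (x : ℕ) := leOfHom b
    by_cases hv : s.Supports v
    · have hw : s.Supports w := ⟨by have := hv.1; omega, by have := hx.2; omega⟩
      simp [intervalMap, hv, hw]
    · simp [intervalMap, hv]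

/-- The isomorphism class of `M_{i,j}`. -/
noncomputable def moduleClass (k : Type u) [Field k] {n : ℕ} (s : Strand n) : IsoClass k n :=
  isoClass (intervalModule k s)

/-- The strand diagram of a set of isomorphism classes: all `c(i, j)` with `M_{i,j}` in the set. -/
def strands {k : Type u} [Field k] {n : ℕ} (E : Set (IsoClass k n)) : Set (Strand n) :=
  {s | moduleClass k s ∈ E}

/-! ### The labelled ternary tree of a strand diagram -/

/-- The graph on `{0, …, n}` whose edges are the strands of a diagram. -/
def strandGraph {n : ℕ} (D : Set (Strand n)) : SimpleGraph (Fin (n + 1)) :=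
  SimpleGraph.fromRel fun p q => ∃ s ∈ D, s.i = p ∧ s.j = q

/-- `c(i, j)` is oriented to the right: `i` is closer to the root `0` than `j`. -/
def OrientedRight {n : ℕ} (D : Set (Strand n)) (s : Strand n) : Prop :=
  (strandGraph D).dist 0 s.i < (strandGraph D).dist 0 s.j

/-- `c(i, j)` is oriented to the left: `j` is closer to the root `0` than `i`. -/
def OrientedLeft {n : ℕ} (D : Set (Strand n)) (s : Strand n) : Prop :=
  (strandGraph D).dist 0 s.j < (strandGraph D).dist 0 s.i

/-- The strands `c(0, j)` of the diagram; the largest of them is the root `R` of the tree. -/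
def rootCandidates {n : ℕ} (D : Set (Strand n)) : Set (Strand n) :=
  {Y ∈ D | Y.i = 0}

/-- The strands of the diagram among which the largest one is `Xa`: for `X = c(i, j)` oriented to
the right, all `c(i, x)` with `x < j`; oriented to the left, all `c(x, j)` with `i < x`. -/
def aCandidates {n : ℕ} (D : Set (Strand n)) (X : Strand n) : Set (Strand n) :=
  {Y ∈ D | (OrientedRight D X ∧ Y.i = X.i ∧ Y.j < X.j) ∨
    (OrientedLeft D X ∧ Y.j = X.j ∧ X.i < Y.i)}

/-- The strands of the diagram among which the largest one is `Xb`: for `X = c(i, j)` oriented to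
the right, all `c(y, j)` with `i < y`; oriented to the left, all `c(i, y)` with `y < j`. -/
def bCandidates {n : ℕ} (D : Set (Strand n)) (X : Strand n) : Set (Strand n) :=
  {Y ∈ D | (OrientedRight D X ∧ Y.j = X.j ∧ X.i < Y.i) ∨
    (OrientedLeft D X ∧ Y.i = X.i ∧ Y.j < X.j)}

/-- The strands of the diagram among which the largest one is `Xc`: for `X = c(i, j)` oriented to
the right, all `c(j, z)`; oriented to the left, all `c(z, i)`. -/
def cCandidates {n : ℕ} (D : Set (Strand n)) (X : Strand n) : Set (Strand n) :=
  {Y ∈ D | (OrientedRight D X ∧ Y.i = X.j) ∨ (OrientedLeft D X ∧ Y.j = X.i)}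

/-- Rooted ternary trees whose nodes are labelled by elements of `α`; every node has three ordered
children `a`, `b`, `c`, and leaves are not labelled. -/
inductive TernaryTree (α : Type*) where
  | leaf : TernaryTree α
  | node (x : α) (a b c : TernaryTree α) : TernaryTree α

namespace TernaryTree

/-- The underlying unlabelled tree. -/
def shape {α : Type*} : TernaryTree α → TernaryTree Unit
  | leaf => leaf
  | node _ a b c => node () a.shape b.shape c.shape

/-- The number of nodes (leaves are not counted). -/
def numNodes {α : Type*} : TernaryTree α → ℕ
  | leaf => 0
  | node _ a b c => 1 + a.numNodes + b.numNodes + c.numNodes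

/-- The number of leaves. -/
def numLeaves {α : Type*} : TernaryTree α → ℕ
  | leaf => 1
  | node _ a b c => a.numLeaves + b.numLeaves + c.numLeaves

/-- The vertices (nodes and leaves) of a tree, each given by its address, a word in the letters
`a = 0`, `b = 1`, `c = 2` read from the root `R`, which is the empty word, and by its node label
(`none` for a leaf).  They are listed with the root first, then the vertices below `a`, `b`, `c`. -/
def vertices {α : Type*} : TernaryTree α → List (List (Fin 3) × Option α)
  | leaf => [([], none)]
  | node x a b c =>
      ([], some x) ::
        (a.vertices.map (Prod.map (List.cons 0) id) ++
          b.vertices.map (Prod.map (List.cons 1) id) ++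
          c.vertices.map (Prod.map (List.cons 2) id))

/-- `t` is the labelled tree obtained from the diagram `D` when its root has to be the largest
strand of `C`: if `C` is empty it is a leaf, and otherwise its root is labelled by the largest
element `X` of `C` and its three subtrees start with `Xa`, `Xb`, `Xc`. -/
def IsGrownFrom {n : ℕ} (D : Set (Strand n)) : Set (Strand n) → TernaryTree (Strand n) → Prop
  | C, leaf => C = ∅
  | C, node X a b c => IsGreatest C X ∧ IsGrownFrom D (aCandidates D X) a ∧
      IsGrownFrom D (bCandidates D X) b ∧ IsGrownFrom D (cCandidates D X) c

/-- `t` is the labelled ternary tree of the strand diagram `D`. -/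
def IsTreeOf {n : ℕ} (D : Set (Strand n)) (t : TernaryTree (Strand n)) : Prop :=
  t.IsGrownFrom D (rootCandidates D)

end TernaryTree

/-! ### Lattice paths -/

/-- A unit step of a lattice path. -/
inductive Step where
  | up
  | right
deriving DecidableEq

/-- The point reached from `(0, 0)` after the first `m` steps of `p`. -/
def pointAfter (p : List Step) (m : ℕ) : ℕ × ℕ :=
  ((p.take m).count Step.right, (p.take m).count Step.up)

/-- `p` is a lattice path of height `n`: it leads from `(0, 0)` to `(2n+1, n)`, and all its points
except the last one satisfy `x ≤ 2y`. -/
def IsLatticePath (n : ℕ) (p : List Step) : Prop :=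
  pointAfter p p.length = (2 * n + 1, n) ∧
    ∀ m < p.length, (pointAfter p m).1 ≤ 2 * (pointAfter p m).2

/-- Lattice paths of height `n`. -/
def LatticePath (n : ℕ) : Type := {p : List Step // IsLatticePath n p}

/-- The vertical edges of a path, given by the positions of its steps up. -/
def VerticalEdge (p : List Step) : Type := {m : ℕ // p[m]? = some Step.up}

/-- The first coordinate of a vertical edge. -/
def VerticalEdge.firstCoord {p : List Step} (e : VerticalEdge p) : ℕ :=
  (pointAfter p e.1).1

/-- The edge of the path given by a vertex of a tree: a node is a step up, a leaf is a step to the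
right. -/
def stepOf {α : Type*} : Option α → Step
  | some _ => Step.up
  | none => Step.right

end StraightA

open StraightA

/-! The representation theory reduces to a condition on pairs of strands. Write W_v for the space of
a representation W at v, with W_0 = 0. The injective resolution 0 → M_{i,j} → M_{0,j} → M_{0,i} → 0
shows that Hom(W, M_{i,j}) is dual to the cokernel of W_i → W_j and Ext^1(W, M_{i,j}) to its kernel.
So both vanish exactly when W_i → W_j is bijective (`homExtVanish_iff`). Exceptional objects are
interval modules (`exists_iso_intervalModule`), so an exceptional sequence is a sequence of strands
in which the support of a later strand contains both endpoints of an earlier one or neither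
(`Prec`).

Such strands do not cross, and their dimension vectors are linearly independent, so at most r - l of
them live on {l, …, r}. When this bound is attained, the longest strand X at an end vertex splits
the set into three sets on smaller intervals, each again attaining its bound
(`Ordered.exists_split_right`, `Ordered.exists_split_left`, `Ordered.card_split`). The recursion
gives a ternary tree satisfying `Planted`. Conversely the labels of every planted tree can be
ordered, and node counts determine all endpoints, so planted trees on {0, …, n} correspond to
unlabelled trees with n nodes. Depth in the noncrossing tree agrees with graph distance, which
identifies the planted tree with the greedily grown one (`Planted.isGrownFrom`). Reading nodes as up
steps and leaves as right steps is the usual prefix code for ternary trees.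

For relative injectivity, give the root the sign "right"; children a and c inherit the sign, b
reverses it. Every subtree has an odd number of leaves, so the sign records the parity of the leaves
read before the node, that is, of the first coordinate (`leafParities_opts`). On the other side
(`Planted.perp_of_sign`), for a strand c(i, j) with sign "right" all W perpendicular to the earlier
terms have a bijective map from W_i to W_z for some z ≥ j, which lets maps to M_{i,j} extend. For
sign "left" some longer M_{y,j} is perpendicular to the earlier terms and contains M_{i,j} as a
subobject that does not split off. -/

namespace StraightA

/-! ### Representations as vector spaces indexed by all natural numbers, zero outside 1, …, n -/

section Representations

variable {k : Type u} [Field k] {n : ℕ}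

/-- The space of a representation at the vertex `v` of the quiver, for an arbitrary natural number
`v`; it is zero unless `1 ≤ v ≤ n`. -/
def Fib (W : QuiverRep k n) (v : ℕ) : Type u :=
  (h : PLift (1 ≤ v ∧ v ≤ n)) → W.obj ⟨v - 1, by have := h.down; omega⟩

noncomputable instance (W : QuiverRep k n) (v : ℕ) : AddCommGroup (Fib W v) :=
  inferInstanceAs (AddCommGroup ((h : PLift (1 ≤ v ∧ v ≤ n)) → W.obj ⟨v - 1, _⟩))

noncomputable instance (W : QuiverRep k n) (v : ℕ) : Module k (Fib W v) :=
  inferInstanceAs (Module k ((h : PLift (1 ≤ v ∧ v ≤ n)) → W.obj ⟨v - 1, _⟩))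

theorem fib_subsingleton (W : QuiverRep k n) {v : ℕ} (h : ¬ (1 ≤ v ∧ v ≤ n)) :
    Subsingleton (Fib W v) :=
  ⟨fun _ _ => funext fun h' => (h h'.down).elim⟩

/-- Evaluation of an element of `Fib W (v + 1)`. -/
noncomputable def Fib.eval (W : QuiverRep k n) (v : Fin n) : Fib W (v + 1) ≃ₗ[k] W.obj v where
  toFun x := x ⟨by omega⟩
  invFun x := fun _ => x
  map_add' _ _ := rfl
  map_smul' _ _ := rfl
  left_inv _ := rfl
  right_inv _ := rfl

open Classical in
/-- The structure maps of a representation, extended by zero. -/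
noncomputable def tr (W : QuiverRep k n) (a b : ℕ) (hab : a ≤ b) : Fib W a →ₗ[k] Fib W b where
  toFun f h := if ha : 1 ≤ a ∧ a ≤ n then
    (W.map (homOfLE (by
      have := h.down
      rw [Fin.mk_le_mk]; omega) :
      (⟨a - 1, by omega⟩ : Fin n) ⟶ ⟨b - 1, by have := h.down; omega⟩)).hom.hom (f ⟨ha⟩) else 0
  map_add' f g := by
    funext h
    by_cases ha : 1 ≤ a ∧ a ≤ n
    · simp only [ha, and_self, dite_true]
      exact map_add _ _ _
    · simp only [ha, dite_false]
      exact (add_zero _).symm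
  map_smul' c f := by
    funext h
    by_cases ha : 1 ≤ a ∧ a ≤ n
    · simp only [ha, and_self, dite_true]
      exact map_smul _ _ _
    · simp only [ha, dite_false]
      exact (smul_zero (M := k) (A := W.obj ⟨b - 1, by have := h.down; omega⟩) c).symm

theorem tr_apply (W : QuiverRep k n) {a b : ℕ} (hab : a ≤ b) (ha : 1 ≤ a ∧ a ≤ n) (f : Fib W a)
    (h : PLift (1 ≤ b ∧ b ≤ n)) :
    tr W a b hab f h = (W.map (homOfLE (by
      have := h.down
      rw [Fin.mk_le_mk]; omega) :
      (⟨a - 1, by omega⟩ : Fin n) ⟶ ⟨b - 1, by have := h.down; omega⟩)).hom.hom (f ⟨ha⟩) := by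
  exact dif_pos ha

theorem tr_refl (W : QuiverRep k n) (a : ℕ) (f : Fib W a) : tr W a a le_rfl f = f := by
  funext h
  rw [tr_apply W le_rfl h.down]
  have : (homOfLE (le_refl _) : (⟨a - 1, by have := h.down; omega⟩ : Fin n) ⟶ _) = 𝟙 _ :=
    Subsingleton.elim _ _
  erw [this, W.map_id]
  rfl

theorem tr_tr (W : QuiverRep k n) {a b c : ℕ} (hab : a ≤ b) (hbc : b ≤ c) (f : Fib W a) :
    tr W b c hbc (tr W a b hab f) = tr W a c (hab.trans hbc) f := by
  funext h
  by_cases ha : 1 ≤ a ∧ a ≤ n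
  · have hb : 1 ≤ b ∧ b ≤ n := by have := h.down; omega
    rw [tr_apply W hbc hb, tr_apply W _ ha, tr_apply W _ ha]
    rw [← LinearMap.comp_apply, ← FGModuleCat.hom_hom_comp, ← W.map_comp]
    rfl
  · have := fib_subsingleton W ha
    rw [Subsingleton.elim f 0]
    simp

/-- The structure map along an arrow, in terms of `tr`. -/
theorem map_eval (W : QuiverRep k n) {v w : Fin n} (a : v ⟶ w) (f : Fib W (v + 1)) :
    (W.map a).hom.hom (Fib.eval W v f) =
      Fib.eval W w (tr W (v + 1) (w + 1) (by have := leOfHom a; omega) f) := by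
  have := tr_apply W (a := v + 1) (b := w + 1) (by have := leOfHom a; omega) (by omega) f
    ⟨by omega⟩
  exact this.symm

/-- The map induced by a morphism of representations at an arbitrary vertex. -/
noncomputable def fibMap {X Y : QuiverRep k n} (f : X ⟶ Y) (v : ℕ) : Fib X v →ₗ[k] Fib Y v where
  toFun x h := (f.app _).hom.hom (x h)
  map_add' x y := funext fun h => map_add (f.app _).hom.hom (x h) (y h)
  map_smul' c x := funext fun h => map_smul (f.app _).hom.hom c (x h)

theorem fibMap_tr {X Y : QuiverRep k n} (f : X ⟶ Y) {a b : ℕ} (hab : a ≤ b) (x : Fib X a) :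
    fibMap f b (tr X a b hab x) = tr Y a b hab (fibMap f a x) := by
  funext h
  by_cases ha : 1 ≤ a ∧ a ≤ n
  · rw [tr_apply Y _ ha]
    change (f.app _).hom.hom (tr X a b hab x h) = _
    rw [tr_apply X _ ha]
    change _ = (Y.map _).hom.hom ((f.app _).hom.hom (x ⟨ha⟩))
    rw [← LinearMap.comp_apply, ← FGModuleCat.hom_hom_comp, f.naturality]
    rfl
  · have := fib_subsingleton X ha
    rw [Subsingleton.elim x 0]
    simp

theorem fibMap_comp {X Y Z : QuiverRep k n} (f : X ⟶ Y) (g : Y ⟶ Z) (v : ℕ) (x : Fib X v) :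
    fibMap (f ≫ g) v x = fibMap g v (fibMap f v x) := rfl

theorem fibMap_id (X : QuiverRep k n) (v : ℕ) (x : Fib X v) : fibMap (𝟙 X) v x = x := rfl

theorem fibMap_zero (X Y : QuiverRep k n) (v : ℕ) (x : Fib X v) :
    fibMap (0 : X ⟶ Y) v x = 0 := rfl

theorem hom_eq_of_fibMap {X Y : QuiverRep k n} {f g : X ⟶ Y}
    (h : ∀ v, ∀ x : Fib X v, fibMap f v x = fibMap g v x) : f = g := by
  ext v x
  exact congrFun (h (v + 1) ((Fib.eval X v).symm x)) ⟨by omega⟩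

/-- A morphism of representations from compatible linear maps. -/
noncomputable def homOfFib {X Y : QuiverRep k n} (f : ∀ v, Fib X v →ₗ[k] Fib Y v)
    (hf : ∀ a b (hab : a ≤ b) (x : Fib X a), f b (tr X a b hab x) = tr Y a b hab (f a x)) :
    X ⟶ Y where
  app v := FGModuleCat.ofHom
    ((Fib.eval Y v).toLinearMap ∘ₗ f (v + 1) ∘ₗ (Fib.eval X v).symm.toLinearMap)
  naturality v w a := by
    apply FGModuleCat.hom_ext
    apply LinearMap.ext
    intro x
    obtain ⟨x, rfl⟩ := (Fib.eval X v).surjective x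
    change Fib.eval Y w (f _ ((Fib.eval X w).symm ((X.map a).hom.hom (Fib.eval X v x)))) =
      (Y.map a).hom.hom (Fib.eval Y v (f _ ((Fib.eval X v).symm (Fib.eval X v x))))
    rw [map_eval, map_eval, LinearEquiv.symm_apply_apply, LinearEquiv.symm_apply_apply, hf]

theorem fibMap_homOfFib {X Y : QuiverRep k n} (f : ∀ v, Fib X v →ₗ[k] Fib Y v)
    (hf : ∀ a b (hab : a ≤ b) (x : Fib X a), f b (tr X a b hab x) = tr Y a b hab (f a x))
    (v : ℕ) (x : Fib X v) : fibMap (homOfFib f hf) v x = f v x := by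
  by_cases hv : 1 ≤ v ∧ v ≤ n
  · obtain ⟨v, rfl⟩ : ∃ w, v = w + 1 := ⟨v - 1, by omega⟩
    funext h
    change f (v + 1) ((Fib.eval X ⟨v, by omega⟩).symm (x h)) h = f (v + 1) x h
    have : (Fib.eval X ⟨v, by omega⟩).symm (x h) = x :=
      (Fib.eval X ⟨v, by omega⟩).symm_apply_apply x
    rw [this]
  · have := fib_subsingleton Y hv
    exact Subsingleton.elim _ _

theorem isIso_of_fibMap_bijective {X Y : QuiverRep k n} (f : X ⟶ Y)
    (h : ∀ v, Function.Bijective (fibMap f v)) : IsIso f := by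
  let e : ∀ v, Fib X v ≃ₗ[k] Fib Y v := fun v => LinearEquiv.ofBijective (fibMap f v) (h v)
  refine ⟨homOfFib (fun v => (e v).symm.toLinearMap) ?_, ?_, ?_⟩
  · intro a b hab y
    obtain ⟨x, rfl⟩ := (e a).surjective y
    apply (e b).injective
    have h1 : (e b) (tr X a b hab x) = tr Y a b hab (e a x) := fibMap_tr f hab x
    simp [h1]
  · apply hom_eq_of_fibMap
    intro v x
    rw [fibMap_comp, fibMap_homOfFib, fibMap_id]
    exact (e v).symm_apply_apply x
  · apply hom_eq_of_fibMap
    intro v x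
    rw [fibMap_comp, fibMap_homOfFib, fibMap_id]
    exact (e v).apply_symm_apply x

/-! ### Kernels -/

/-- The kernel of a morphism of representations, computed vertexwise. -/
noncomputable def kernelRep {X Y : QuiverRep k n} (f : X ⟶ Y) : QuiverRep k n where
  obj v := FGModuleCat.of k (LinearMap.ker (f.app v).hom.hom)
  map {v w} a := FGModuleCat.ofHom (((X.map a).hom.hom).restrict (by
    intro x hx
    rw [LinearMap.mem_ker] at hx ⊢
    rw [← LinearMap.comp_apply, ← FGModuleCat.hom_hom_comp, f.naturality]
    change (Y.map a).hom.hom ((f.app v).hom.hom x) = 0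
    rw [hx, map_zero]))
  map_id v := by
    apply FGModuleCat.hom_ext
    apply LinearMap.ext
    intro x
    apply Subtype.ext
    change (X.map (𝟙 v)).hom.hom x.1 = x.1
    rw [X.map_id]
    rfl
  map_comp {u v w} a b := by
    apply FGModuleCat.hom_ext
    apply LinearMap.ext
    intro x
    apply Subtype.ext
    change (X.map (a ≫ b)).hom.hom x.1 = (X.map b).hom.hom ((X.map a).hom.hom x.1)
    rw [X.map_comp]
    rfl

/-- The inclusion of the kernel. -/
noncomputable def kernelRepι {X Y : QuiverRep k n} (f : X ⟶ Y) : kernelRep f ⟶ X where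
  app v := FGModuleCat.ofHom (LinearMap.ker (f.app v).hom.hom).subtype
  naturality _ _ _ := rfl

theorem kernelRepι_comp {X Y : QuiverRep k n} (f : X ⟶ Y) : kernelRepι f ≫ f = 0 := by
  ext v x
  exact x.2

theorem kernelRepι_injective {X Y : QuiverRep k n} (f : X ⟶ Y) (v : ℕ) :
    Function.Injective (fibMap (kernelRepι f) v) := by
  intro x y h
  funext h'
  exact Subtype.ext (congrFun h h')

theorem exists_kernelRep {X Y : QuiverRep k n} (f : X ⟶ Y) (v : ℕ) (x : Fib X v)
    (h : fibMap f v x = 0) : ∃ y, fibMap (kernelRepι f) v y = x :=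
  ⟨fun h' => ⟨x h', congrFun h h'⟩, rfl⟩

/-- A diagram chase. It makes left perpendicular categories closed under kernels, because they are
cut out by bijectivity of structure maps. -/
theorem tr_kernelRep_bijective {X Y : QuiverRep k n} (f : X ⟶ Y) {a b : ℕ} (hab : a ≤ b)
    (hX : Function.Bijective (tr X a b hab)) (hY : Function.Bijective (tr Y a b hab)) :
    Function.Bijective (tr (kernelRep f) a b hab) := by
  constructor
  · intro x y h
    apply kernelRepι_injective f
    apply hX.1
    rw [← fibMap_tr, ← fibMap_tr, h]
  · intro y
    obtain ⟨x, hx⟩ := hX.2 (fibMap (kernelRepι f) b y)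
    have h0 : fibMap f a x = 0 := by
      apply hY.1
      rw [← fibMap_tr, hx, ← fibMap_comp, kernelRepι_comp, fibMap_zero, map_zero]
    obtain ⟨z, rfl⟩ := exists_kernelRep f a x h0
    refine ⟨z, kernelRepι_injective f b ?_⟩
    rw [fibMap_tr, hx]

theorem fibMap_injective_of_kernel {X Y : QuiverRep k n} {f : X ⟶ Y} (h : kernelRepι f = 0)
    (v : ℕ) : Function.Injective (fibMap f v) := by
  rw [injective_iff_map_eq_zero]
  intro x hx
  obtain ⟨y, rfl⟩ := exists_kernelRep f v x hx
  rw [h, fibMap_zero]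

theorem fibMap_injective_of_mono {X Y : QuiverRep k n} (f : X ⟶ Y) [Mono f] (v : ℕ) :
    Function.Injective (fibMap f v) :=
  fibMap_injective_of_kernel (by rw [← cancel_mono f, kernelRepι_comp, Limits.zero_comp]) v

end Representations

end StraightA

/-! ### Interval modules and the morphisms into and out of them -/

namespace StraightA

section Intervals

variable {k : Type u} [Field k] {n : ℕ}

/-- The natural number `v` lies in the support `(i, j]` of the strand `c(i, j)`. -/
def Strand.Mem (v : ℕ) (s : Strand n) : Prop := (s.i : ℕ) < v ∧ v ≤ (s.j : ℕ)

theorem Strand.Mem.bound {v : ℕ} {s : Strand n} (h : s.Mem v) : 1 ≤ v ∧ v ≤ n := by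
  have := h.1; have := h.2; omega

theorem Strand.Mem.supports {v : ℕ} {s : Strand n} (h : s.Mem v) :
    s.Supports ⟨v - 1, by have := h.bound; omega⟩ := by
  have := h.1; have := h.2
  constructor <;> dsimp only <;> omega

/-- The space of `M_{i,j}` at a vertex of its support is one-dimensional. -/
noncomputable def coord {v : ℕ} {s : Strand n} (h : s.Mem v) :
    Fib (intervalModule k s) v ≃ₗ[k] k where
  toFun x := x ⟨h.bound⟩ ⟨h.supports⟩
  invFun c := fun _ _ => c
  map_add' _ _ := rfl
  map_smul' _ _ := rfl
  left_inv _ := rfl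
  right_inv _ := rfl

theorem fib_interval_subsingleton {v : ℕ} {s : Strand n} (h : ¬ s.Mem v) :
    Subsingleton (Fib (intervalModule k s) v) := by
  refine ⟨fun x y => funext fun h1 => funext fun h2 => (h ?_).elim⟩
  have h3 := h1.down
  have h4 := h2.down.1
  have h5 := h2.down.2
  dsimp only at h4 h5
  constructor <;> omega

theorem coord_tr {a b : ℕ} {s : Strand n} (ha : s.Mem a) (hb : s.Mem b) (hab : a ≤ b)
    (x : Fib (intervalModule k s) a) :
    coord hb (tr _ a b hab x) = coord ha x := by
  change tr _ a b hab x ⟨hb.bound⟩ ⟨hb.supports⟩ = _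
  rw [tr_apply _ hab ha.bound]
  change intervalMap k s _ _ (x ⟨ha.bound⟩) ⟨hb.supports⟩ = _
  exact dif_pos ha.supports

/-- Each space is zero or a line, and the structure map between two lines is the identity. This is
how perpendicularity turns into combinatorics of supports. -/
theorem tr_interval_bijective {a b : ℕ} {s : Strand n} (hab : a ≤ b) :
    Function.Bijective (tr (intervalModule k s) a b hab) ↔ (s.Mem a ↔ s.Mem b) := by
  constructor
  · intro h
    by_cases ha : s.Mem a
    · refine iff_of_true ha ?_
      by_contra hb
      have := fib_interval_subsingleton (k := k) hb
      have h1 := h.1 (Subsingleton.elim (tr _ a b hab ((coord ha).symm 1)) (tr _ a b hab 0))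
      have h2 := congrArg (coord ha) h1
      simp at h2
    · refine iff_of_false ha ?_
      intro hb
      have := fib_interval_subsingleton (k := k) ha
      obtain ⟨x, hx⟩ := h.2 ((coord hb).symm 1)
      rw [Subsingleton.elim x 0, map_zero] at hx
      have h2 := congrArg (coord hb) hx
      simp at h2
  · intro h
    by_cases ha : s.Mem a
    · have hb := h.1 ha
      constructor
      · intro x y hxy
        apply (coord ha).injective
        rw [← coord_tr ha hb hab, ← coord_tr ha hb hab, hxy]
      · intro y
        refine ⟨(coord ha).symm (coord hb y), (coord hb).injective ?_⟩
        rw [coord_tr ha hb hab, LinearEquiv.apply_symm_apply]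
    · have hb : ¬ s.Mem b := fun hb => ha (h.2 hb)
      have := fib_interval_subsingleton (k := k) ha
      have := fib_interval_subsingleton (k := k) hb
      exact ⟨Function.injective_of_subsingleton _, fun y => ⟨0, Subsingleton.elim _ _⟩⟩

theorem Strand.mem_top (s : Strand n) : s.Mem s.j := ⟨s.lt, le_rfl⟩

theorem Strand.mem_bot (s : Strand n) : s.Mem (s.i + 1) := ⟨Nat.lt_succ_self _, s.lt⟩

theorem Strand.le (s : Strand n) : (s.i : ℕ) ≤ s.j := le_of_lt s.lt

/-! ### Morphisms to and from interval modules -/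

open Classical in
/-- A linear form at the top of the support which vanishes on the image of the vertex `i` gives a
morphism to `M_{i,j}`. -/
noncomputable def homToInterval (W : QuiverRep k n) (s : Strand n) (φ : Fib W s.j →ₗ[k] k)
    (hφ : ∀ x, φ (tr W s.i s.j s.le x) = 0) : W ⟶ intervalModule k s :=
  homOfFib (fun v => if h : s.Mem v then
    (coord h).symm.toLinearMap ∘ₗ φ ∘ₗ tr W v s.j h.2 else 0) <| by
    intro a b hab x
    by_cases hb : s.Mem b
    · rw [dif_pos hb]
      apply (coord hb).injective
      by_cases ha : s.Mem a
      · rw [dif_pos ha, coord_tr ha hb]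
        simp [tr_tr]
      · rw [dif_neg ha]
        have hai : a ≤ s.i := by
          have := hb.2
          simp only [Strand.Mem, not_and_or, not_lt, not_le] at ha
          omega
        have := hφ (tr W a s.i hai x)
        rw [tr_tr] at this
        simp [tr_tr, this]
    · have := fib_interval_subsingleton (k := k) hb
      exact Subsingleton.elim _ _

theorem coord_homToInterval (W : QuiverRep k n) (s : Strand n) (φ : Fib W s.j →ₗ[k] k)
    (hφ : ∀ x, φ (tr W s.i s.j s.le x) = 0) (v : ℕ) (h : s.Mem v) (x : Fib W v) :
    coord h (fibMap (homToInterval W s φ hφ) v x) = φ (tr W v s.j h.2 x) := by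
  rw [homToInterval, fibMap_homOfFib, dif_pos h]
  simp

/-- The linear form of a morphism to `M_{i,j}`. -/
noncomputable def formOfHom {W : QuiverRep k n} {s : Strand n} (f : W ⟶ intervalModule k s) :
    Fib W s.j →ₗ[k] k :=
  (coord s.mem_top).toLinearMap ∘ₗ fibMap f s.j

theorem formOfHom_apply {W : QuiverRep k n} {s : Strand n} (f : W ⟶ intervalModule k s)
    (x : Fib W s.j) : formOfHom f x = coord s.mem_top (fibMap f s.j x) := rfl

theorem formOfHom_tr {W : QuiverRep k n} {s : Strand n} (f : W ⟶ intervalModule k s)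
    (x : Fib W s.i) : formOfHom f (tr W s.i s.j s.le x) = 0 := by
  have := fib_interval_subsingleton (k := k) (v := s.i) (s := s) (fun h => lt_irrefl _ h.1)
  rw [formOfHom_apply, fibMap_tr, Subsingleton.elim (fibMap f _ x) 0, map_zero, map_zero]

/-- Structure maps within the support preserve coordinates, so every component of a morphism to
`M_{i,j}` can be read off at the top vertex. -/
theorem hom_eq_of_form {W : QuiverRep k n} {s : Strand n} {f g : W ⟶ intervalModule k s}
    (h : ∀ x, formOfHom f x = formOfHom g x) : f = g := by
  apply hom_eq_of_fibMap
  intro v x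
  by_cases hv : s.Mem v
  · apply (coord hv).injective
    rw [← coord_tr hv s.mem_top hv.2, ← coord_tr hv s.mem_top hv.2, ← fibMap_tr, ← fibMap_tr]
    exact h _
  · have := fib_interval_subsingleton (k := k) hv
    exact Subsingleton.elim _ _

theorem formOfHom_homToInterval (W : QuiverRep k n) (s : Strand n) (φ : Fib W s.j →ₗ[k] k)
    (hφ : ∀ x, φ (tr W s.i s.j s.le x) = 0) (x : Fib W s.j) :
    formOfHom (homToInterval W s φ hφ) x = φ x := by
  rw [formOfHom_apply, coord_homToInterval, tr_refl]

theorem formOfHom_comp {X Y : QuiverRep k n} {s : Strand n} (f : X ⟶ Y)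
    (g : Y ⟶ intervalModule k s) (x : Fib X s.j) :
    formOfHom (f ≫ g) x = formOfHom g (fibMap f _ x) := rfl

open Classical in
/-- A vector at the bottom of the support which dies after the vertex `j` gives a morphism from
`M_{i,j}`. -/
noncomputable def homFromInterval (W : QuiverRep k n) (s : Strand n) (w : Fib W (s.i + 1))
    (hw : tr W (s.i + 1) (s.j + 1) (by have := s.le; omega) w = 0) : intervalModule k s ⟶ W :=
  homOfFib (fun v => if h : s.Mem v then
    (LinearMap.toSpanSingleton k _ (tr W (s.i + 1) v h.1 w)) ∘ₗ (coord h).toLinearMap else 0) <| by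
    intro a b hab x
    by_cases ha : s.Mem a
    · rw [dif_pos ha]
      by_cases hb : s.Mem b
      · rw [dif_pos hb]
        simp [coord_tr ha hb hab, tr_tr]
      · rw [dif_neg hb]
        have hjb : s.j + 1 ≤ b := by
          have := ha.1
          simp only [Strand.Mem, not_and_or, not_lt, not_le] at hb
          omega
        have := congrArg (tr W (s.j + 1) b hjb) hw
        rw [tr_tr, map_zero] at this
        simp [tr_tr, this]
    · have := fib_interval_subsingleton (k := k) ha
      rw [Subsingleton.elim x 0]
      simp

theorem fibMap_homFromInterval (W : QuiverRep k n) (s : Strand n) (w : Fib W (s.i + 1))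
    (hw : tr W (s.i + 1) (s.j + 1) (by have := s.le; omega) w = 0) (v : ℕ) (h : s.Mem v)
    (x : Fib (intervalModule k s) v) :
    fibMap (homFromInterval W s w hw) v x = coord h x • tr W (s.i + 1) v h.1 w := by
  rw [homFromInterval, fibMap_homOfFib, dif_pos h]
  simp

/-- Morphisms to `M_{i,j}` are the linear forms on the cokernel of W_i → W_j, and a vector space is
zero when its dual is. -/
theorem forall_hom_eq_zero_iff (W : QuiverRep k n) (s : Strand n) :
    (∀ f : W ⟶ intervalModule k s, f = 0) ↔ Function.Surjective (tr W s.i s.j s.le) := by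
  constructor
  · intro h
    rw [← LinearMap.range_eq_top]
    by_contra hne
    obtain ⟨φ, hφ, hle⟩ := Submodule.exists_le_ker_of_lt_top _ (lt_top_iff_ne_top.2 hne)
    apply hφ
    apply LinearMap.ext
    intro x
    have h0 : ∀ x, φ (tr W s.i s.j s.le x) = 0 := fun x => hle (LinearMap.mem_range_self _ x)
    rw [← formOfHom_homToInterval W s φ h0, h (homToInterval W s φ h0)]
    exact (coord (k := k) s.mem_top).map_zero
  · intro h f
    apply hom_eq_of_form
    intro x
    obtain ⟨y, rfl⟩ := h x
    rw [formOfHom_tr, formOfHom_tr]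

/-- Extension of morphisms to `M_{i,j}` along vertexwise injective ones, when the structure maps
from `i` to some vertex beyond `j` are bijective. -/
theorem exists_extension {X Y : QuiverRep k n} {s : Strand n} (z : ℕ) (hz : (s.j : ℕ) ≤ z)
    (hX : Function.Bijective (tr X s.i z (s.le.trans hz)))
    (hY : Function.Bijective (tr Y s.i z (s.le.trans hz)))
    (f : X ⟶ Y) (hf : Function.Injective (fibMap f s.j)) (g : X ⟶ intervalModule k s) :
    ∃ h : Y ⟶ intervalModule k s, f ≫ h = g := by
  obtain ⟨r, hr⟩ := LinearMap.exists_leftInverse_of_injective (fibMap f s.j)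
    (LinearMap.ker_eq_bot.2 hf)
  let e := LinearEquiv.ofBijective _ hY
  -- The projection of Y_j onto the kernel of Y_j → Y_z along the image of Y_i. Composing with it
  -- forces the form to vanish on that image; on vectors from X it only subtracts something coming
  -- from X_i, which the form of `g` ignores.
  let π : Fib Y s.j →ₗ[k] Fib Y s.j :=
    LinearMap.id - tr Y s.i s.j s.le ∘ₗ e.symm.toLinearMap ∘ₗ tr Y s.j z hz
  refine ⟨homToInterval Y s (formOfHom g ∘ₗ r ∘ₗ π) ?_, hom_eq_of_form fun x => ?_⟩
  · intro x
    have h1 : e.symm (tr Y s.i z (s.le.trans hz) x) = x := e.symm_apply_apply x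
    simp [π, tr_tr, h1]
  · rw [formOfHom_comp, formOfHom_homToInterval]
    obtain ⟨y, hy⟩ := hX.2 (tr X s.j z hz x)
    have h1 : e.symm (tr Y s.j z hz (fibMap f s.j x)) = fibMap f s.i y := by
      rw [LinearEquiv.symm_apply_eq]
      change _ = tr Y s.i z (s.le.trans hz) (fibMap f s.i y)
      rw [← fibMap_tr, ← fibMap_tr, hy]
    have h2 : π (fibMap f s.j x) = fibMap f s.j (x - tr X s.i s.j s.le y) := by
      simp [π, h1, fibMap_tr]
    have h3 : ∀ x, r (fibMap f s.j x) = x := fun x => LinearMap.congr_fun hr x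
    rw [LinearMap.comp_apply, LinearMap.comp_apply, h2, h3, map_sub, formOfHom_tr, sub_zero]

/-- Both spaces are zero. This trivial bijection is the case of `exists_extension` behind
injectivity of `M_{0,j}`, and later the starting point of the induction from the root. -/
theorem tr_zero_top_bijective (W : QuiverRep k n) {a z : ℕ} (ha : a = 0) (hz : n < z) :
    Function.Bijective (tr W a z (by omega)) := by
  have := fib_subsingleton W (v := a) (by omega)
  have := fib_subsingleton W (v := z) (by omega)
  exact ⟨Function.injective_of_subsingleton _, fun y => ⟨0, Subsingleton.elim _ _⟩⟩

theorem injective_intervalModule (s : Strand n) (hs : (s.i : ℕ) = 0) :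
    Injective (intervalModule k s) where
  factors {X Y} g f _ :=
    exists_extension (n + 1) (by omega) (tr_zero_top_bijective X hs n.lt_succ_self)
      (tr_zero_top_bijective Y hs n.lt_succ_self) f (fibMap_injective_of_mono f _) g

end Intervals

end StraightA

/-! ### Ext groups from injective resolutions of length one -/

theorem CategoryTheory.Abelian.Ext.subsingleton_one_iff {C : Type*} [Category C] [Abelian C]
    [HasExt C] {S : ShortComplex C} (hS : S.ShortExact) [Injective S.X₂] (W : C) :
    Subsingleton (Abelian.Ext W S.X₁ 1) ↔ ∀ g : W ⟶ S.X₃, ∃ h : W ⟶ S.X₂, h ≫ S.g = g := by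
  constructor
  · intro _ g
    obtain ⟨x, hx⟩ := Abelian.Ext.covariant_sequence_exact₃ W hS (Abelian.Ext.mk₀ g) (zero_add 1)
      (Subsingleton.elim _ _)
    obtain ⟨h, rfl⟩ := (Abelian.Ext.mk₀_bijective W S.X₂).2 x
    rw [Abelian.Ext.mk₀_comp_mk₀] at hx
    exact ⟨h, (Abelian.Ext.mk₀_bijective W S.X₃).1 hx⟩
  · intro H
    refine subsingleton_of_forall_eq 0 fun x => ?_
    obtain ⟨y, rfl⟩ := Abelian.Ext.covariant_sequence_exact₁ W hS x
      (Abelian.Ext.eq_zero_of_injective _) (zero_add 1)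
    obtain ⟨g, rfl⟩ := (Abelian.Ext.mk₀_bijective W S.X₃).2 y
    obtain ⟨h, rfl⟩ := H g
    rw [← Abelian.Ext.mk₀_comp_mk₀, Abelian.Ext.comp_assoc_of_second_deg_zero, hS.comp_extClass,
      Abelian.Ext.comp_zero]

/-- Dimension shift: every class comes from Ext^(d+1) into the injective third term. -/
theorem CategoryTheory.Abelian.Ext.subsingleton_add_two {C : Type*} [Category C] [Abelian C]
    [HasExt C] {S : ShortComplex C} (hS : S.ShortExact) [Injective S.X₂] [Injective S.X₃] (W : C)
    (d : ℕ) : Subsingleton (Abelian.Ext W S.X₁ (d + 2)) := by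
  refine subsingleton_of_forall_eq 0 fun x => ?_
  obtain ⟨y, rfl⟩ := Abelian.Ext.covariant_sequence_exact₁ W hS x
    (Abelian.Ext.eq_zero_of_injective (n := d + 1) _) rfl
  rw [Abelian.Ext.eq_zero_of_injective (n := d) y, Abelian.Ext.zero_comp]

namespace StraightA

section Ext

variable {k : Type u} [Field k] {n : ℕ}

theorem epi_of_fibMap_surjective {X Y : QuiverRep k n} (f : X ⟶ Y)
    (h : ∀ v, Function.Surjective (fibMap f v)) : Epi f where
  left_cancellation {Z} g g' hg := by
    apply hom_eq_of_fibMap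
    intro v y
    obtain ⟨x, rfl⟩ := h v y
    rw [← fibMap_comp, ← fibMap_comp, hg]

/-- The strand `c(0, v)`. -/
abbrev initialStrand (v : Fin (n + 1)) (hv : 0 < v) : Strand n := ⟨0, v, hv⟩

theorem fib_zero_eq (W : QuiverRep k n) (y : Fib W ((0 : Fin (n + 1)) : ℕ)) : y = 0 :=
  (fib_subsingleton W (v := ((0 : Fin (n + 1)) : ℕ)) (by simp)).elim _ _

/-- The inclusion of `M_{i,j}` into its injective hull `M_{0,j}`. -/
noncomputable def hullι (s : Strand n) :
    intervalModule k s ⟶ intervalModule k (initialStrand s.j ((Fin.zero_le _).trans_lt s.lt)) :=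
  homToInterval _ _ (coord (k := k) s.mem_top).toLinearMap <| by
    intro x
    rw [fib_zero_eq _ x, map_zero, map_zero]

/-- The quotient `M_{0,i}` of the injective hull `M_{0,j}` of `M_{i,j}`. -/
noncomputable def hullπ (s : Strand n) (hs : 0 < s.i) :
    intervalModule k (initialStrand s.j (hs.trans s.lt)) ⟶
      intervalModule k (initialStrand s.i hs) :=
  homToInterval _ _ ((coord (k := k) (s := initialStrand s.j (hs.trans s.lt)) (v := s.i)
    ⟨hs, s.le⟩).toLinearMap) <| by
    intro x
    rw [fib_zero_eq _ x, map_zero, map_zero]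

theorem formOfHom_comp_hullι {W : QuiverRep k n} {s : Strand n} (f : W ⟶ intervalModule k s)
    (x : Fib W s.j) : formOfHom (f ≫ hullι s) x = formOfHom f x := by
  rw [formOfHom_comp]
  exact formOfHom_homToInterval _ _ _ _ _

theorem formOfHom_comp_hullπ {W : QuiverRep k n} {s : Strand n} (hs : 0 < s.i)
    (f : W ⟶ intervalModule k (initialStrand s.j (hs.trans s.lt))) (x : Fib W s.i) :
    formOfHom (f ≫ hullπ s hs) x = formOfHom f (tr W s.i s.j s.le x) := by
  rw [formOfHom_comp]
  refine (formOfHom_homToInterval _ _ _ _ _).trans ?_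
  have := coord_tr (k := k) (s := initialStrand s.j (hs.trans s.lt)) (a := s.i) (b := s.j)
    ⟨hs, s.le⟩ (Strand.mem_top _) s.le (fibMap f s.i x)
  rw [← fibMap_tr] at this
  exact this.symm

/-- The minimal injective resolution of `M_{i,j}` for `0 < i`. -/
noncomputable abbrev hullComplex (k : Type u) [Field k] (s : Strand n) (hs : 0 < s.i) :
    ShortComplex (QuiverRep k n) :=
  ShortComplex.mk (hullι s) (hullπ s hs) <| by
    apply hom_eq_of_form
    intro x
    refine (formOfHom_comp_hullπ hs _ _).trans ?_
    have := formOfHom_comp_hullι (𝟙 (intervalModule k s)) (tr _ s.i s.j s.le x)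
    rw [Category.id_comp, formOfHom_tr] at this
    exact this.trans (coord (k := k) (initialStrand s.i hs).mem_top).map_zero.symm

instance (s : Strand n) : Mono (hullι (k := k) s) where
  right_cancellation {Z} g g' hg := by
    apply hom_eq_of_form
    intro x
    rw [← formOfHom_comp_hullι, hg, formOfHom_comp_hullι]

theorem hullπ_surjective (s : Strand n) (hs : 0 < s.i) (v : ℕ) :
    Function.Surjective (fibMap (hullπ (k := k) s hs) v) := by
  intro y
  by_cases hv : (initialStrand s.i hs).Mem v
  · have hv' : (initialStrand s.j (hs.trans s.lt)).Mem v := ⟨hv.1, hv.2.trans s.le⟩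
    refine ⟨(coord hv').symm (coord hv y), (coord hv).injective ?_⟩
    refine (coord_homToInterval _ _ _ _ v hv _).trans ?_
    exact (coord_tr hv' _ _ _).trans (LinearEquiv.apply_symm_apply _ _)
  · have := fib_interval_subsingleton (k := k) hv
    exact ⟨0, Subsingleton.elim _ _⟩

/-- Composing with `hullπ` restricts the linear form along W_i → W_j. Hence the maps it kills are
exactly those whose form factors through the cokernel, that is, the maps to `M_{i,j}`. -/
theorem hullComplex_shortExact (s : Strand n) (hs : 0 < s.i) :
    (hullComplex k s hs).ShortExact := by
  have : Mono (hullComplex k s hs).f := inferInstanceAs (Mono (hullι s))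
  refine ShortComplex.ShortExact.mk' (ShortComplex.exact_of_f_is_kernel _ ?_) this
    (epi_of_fibMap_surjective _ (hullπ_surjective s hs))
  refine Limits.KernelFork.IsLimit.ofι' _ _ fun {W} g hg => ?_
  have h : ∀ x, formOfHom (s := initialStrand s.j (hs.trans s.lt)) g (tr W s.i s.j s.le x) = 0 := by
    intro x
    refine (formOfHom_comp_hullπ hs g x).symm.trans ?_
    erw [hg]
    exact (coord (k := k) (initialStrand s.i hs).mem_top).map_zero
  refine ⟨homToInterval W s (formOfHom (s := initialStrand s.j (hs.trans s.lt)) g) h,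
    hom_eq_of_form fun x => ?_⟩
  exact (formOfHom_comp_hullι _ _).trans (formOfHom_homToInterval _ _ _ _ _)

theorem extVanishes_add_two (W : QuiverRep k n) (s : Strand n) (d : ℕ) :
    ExtVanishes (d + 2) W (intervalModule k s) := by
  let := HasExt.standard (QuiverRep k n)
  by_cases hs : 0 < s.i
  · have := injective_intervalModule (k := k) (initialStrand s.j (hs.trans s.lt)) rfl
    have := injective_intervalModule (k := k) (initialStrand s.i hs) rfl
    have : Injective (hullComplex k s hs).X₂ := by assumption
    have : Injective (hullComplex k s hs).X₃ := by assumption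
    exact Abelian.Ext.subsingleton_add_two (hullComplex_shortExact (k := k) s hs) W d
  · have := injective_intervalModule (k := k) s (by
      have : s.i = 0 := by simpa using hs
      simp [this])
    exact Abelian.Ext.subsingleton_of_injective W _ (d + 1)

/-- By the resolution, Ext^1 is the space of forms on W_i modulo those pulled back from W_j, the
dual of the kernel of W_i → W_j. A left inverse extends all forms; conversely, if all forms extend,
none detects a vector of the kernel. -/
theorem extVanishes_one_iff (W : QuiverRep k n) (s : Strand n) :
    ExtVanishes 1 W (intervalModule k s) ↔ Function.Injective (tr W s.i s.j s.le) := by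
  let := HasExt.standard (QuiverRep k n)
  by_cases hs : 0 < s.i
  · have := injective_intervalModule (k := k) (initialStrand s.j (hs.trans s.lt)) rfl
    have : Injective (hullComplex k s hs).X₂ := by assumption
    refine (Abelian.Ext.subsingleton_one_iff (hullComplex_shortExact (k := k) s hs) W).trans ?_
    constructor
    · intro H
      rw [injective_iff_map_eq_zero]
      intro x hx
      rw [← Module.forall_dual_apply_eq_zero_iff k]
      intro φ
      obtain ⟨h, hh⟩ := H (homToInterval W (initialStrand s.i hs) φ (fun y => by
        rw [fib_zero_eq _ y, map_zero, map_zero]))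
      have h1 := formOfHom_comp_hullπ hs h x
      rw [hx, map_zero] at h1
      rw [← h1]
      erw [hh]
      exact (formOfHom_homToInterval W (initialStrand s.i hs) φ _ x).symm
    · intro hinj g
      obtain ⟨r, hr⟩ := LinearMap.exists_leftInverse_of_injective _ (LinearMap.ker_eq_bot.2 hinj)
      refine ⟨homToInterval W (initialStrand s.j (hs.trans s.lt))
        (formOfHom (s := initialStrand s.i hs) g ∘ₗ r) (fun y => by
          rw [fib_zero_eq _ y, map_zero, map_zero]), ?_⟩
      apply hom_eq_of_form
      intro x
      refine (formOfHom_comp_hullπ hs _ x).trans ?_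
      refine (formOfHom_homToInterval _ _ _ _ _).trans ?_
      rw [LinearMap.comp_apply]
      exact congrArg _ (LinearMap.congr_fun hr x)
  -- For i = 0 the module is injective and the source W_0 is zero, so both sides hold.
  · have h0 : (s.i : ℕ) = 0 := by
      have : s.i = 0 := by simpa using hs
      simp [this]
    have := injective_intervalModule (k := k) s h0
    have := fib_subsingleton W (v := s.i) (by omega)
    exact iff_of_true (Abelian.Ext.subsingleton_of_injective W _ 0)
      (Function.injective_of_subsingleton _)

theorem homExtVanish_iff (W : QuiverRep k n) (s : Strand n) :
    HomExtVanish W (intervalModule k s) ↔ Function.Bijective (tr W s.i s.j s.le) := by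
  rw [HomExtVanish, forall_hom_eq_zero_iff, extVanishes_one_iff, and_comm]
  rfl

end Ext

end StraightA

/-! ### Classification of exceptional objects, and criteria for relative injectivity -/

namespace StraightA

section Exceptional

variable {k : Type u} [Field k] {n : ℕ}

theorem ExtVanishes.of_iso {V V' W W' : QuiverRep k n} {d : ℕ} (h : ExtVanishes d V W)
    (e : V ≅ V') (e' : W ≅ W') : ExtVanishes d V' W' := by
  let := HasExt.standard (QuiverRep k n)
  have h' : Subsingleton (Abelian.Ext V W d) := h
  refine subsingleton_of_forall_eq (α := Abelian.Ext V' W' d) 0 fun x => ?_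
  have h1 : (Abelian.Ext.mk₀ e.hom).comp (x.comp (Abelian.Ext.mk₀ e'.inv) (add_zero d))
      (zero_add d) = 0 := Subsingleton.elim _ _
  have h2 := congrArg (fun y => (Abelian.Ext.mk₀ e.inv).comp
    (y.comp (Abelian.Ext.mk₀ e'.hom) (add_zero d)) (zero_add d)) h1
  simpa using h2

theorem HomExtVanish.of_iso {V V' W W' : QuiverRep k n} (h : HomExtVanish V W)
    (e : V ≅ V') (e' : W ≅ W') : HomExtVanish V' W' := by
  refine ⟨fun f => ?_, h.2.of_iso e e'⟩
  have h1 := h.1 (e.hom ≫ f ≫ e'.inv)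
  rw [← cancel_epi e.hom, ← cancel_mono e'.inv, Category.assoc, h1]
  simp

/-- `s` may precede `t` in an exceptional sequence of interval modules. -/
def Prec (s t : Strand n) : Prop := t.Mem s.i ↔ t.Mem s.j

theorem homExtVanish_interval_iff (s t : Strand n) :
    HomExtVanish (intervalModule k t) (intervalModule k s) ↔ Prec s t := by
  rw [homExtVanish_iff, tr_interval_bijective, Prec]

/-- By naturality an endomorphism acts at all vertices of the support by one and the same scalar,
its value at the top vertex. -/
theorem coord_endo {s : Strand n} (f : intervalModule k s ⟶ intervalModule k s) {v : ℕ}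
    (hv : s.Mem v) (x : Fib (intervalModule k s) v) :
    coord hv (fibMap f v x) = coord hv x * formOfHom f ((coord s.mem_top).symm 1) := by
  rw [← coord_tr hv s.mem_top hv.2, ← fibMap_tr, ← formOfHom_apply,
    ← coord_tr hv s.mem_top hv.2 x]
  generalize tr _ _ _ _ x = y
  have : y = coord s.mem_top y • (coord s.mem_top).symm (1 : k) := by
    apply (coord s.mem_top).injective
    simp
  conv_lhs => rw [this, map_smul, smul_eq_mul]

theorem id_intervalModule_ne_zero (s : Strand n) : 𝟙 (intervalModule k s) ≠ 0 := by
  intro h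
  have h1 := formOfHom_apply (𝟙 (intervalModule k s)) ((coord s.mem_top).symm 1)
  rw [fibMap_id, LinearEquiv.apply_symm_apply, h] at h1
  exact zero_ne_one ((coord (k := k) s.mem_top).map_zero.symm.trans h1)

theorem isExceptional_intervalModule (s : Strand n) : IsExceptional (intervalModule k s) where
  nontrivial_end := ⟨𝟙 _, 0, id_intervalModule_ne_zero s⟩
  isUnit_of_ne_zero f hf := by
    rw [isUnit_iff_isIso]
    have hc : formOfHom f ((coord s.mem_top).symm 1) ≠ 0 := by
      intro h0
      apply hf
      apply hom_eq_of_form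
      intro x
      rw [formOfHom_apply, coord_endo, h0, mul_zero]
      exact (coord (k := k) s.mem_top).map_zero.symm
    apply isIso_of_fibMap_bijective
    intro v
    by_cases hv : s.Mem v
    · constructor
      · intro x y hxy
        apply (coord hv).injective
        have h := congrArg (coord hv) hxy
        rw [coord_endo, coord_endo] at h
        exact mul_right_cancel₀ hc h
      · intro y
        refine ⟨(coord hv).symm (coord hv y / formOfHom f ((coord s.mem_top).symm 1)),
          (coord hv).injective ?_⟩
        rw [coord_endo, LinearEquiv.apply_symm_apply, div_mul_cancel₀ _ hc]
    · have := fib_interval_subsingleton (k := k) hv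
      exact ⟨Function.injective_of_subsingleton _, fun y => ⟨0, Subsingleton.elim _ _⟩⟩
  ext_self d hd := by
    obtain _ | _ | d := d
    · omega
    · rw [zero_add, extVanishes_one_iff]
      have := fib_interval_subsingleton (k := k) (v := s.i) (s := s) (fun h => lt_irrefl _ h.1)
      exact Function.injective_of_subsingleton _
    · exact extVanishes_add_two _ s d

/-- Follow a nonzero vector at the first nonzero vertex until it dies. It spans a copy of an
interval module, and a linear form at the last vertex where it survives splits this copy off. The
resulting nonzero idempotent in a division ring must be the identity. -/
theorem exists_iso_intervalModule {V : QuiverRep k n} (hV : IsExceptional V) :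
    ∃ s : Strand n, Nonempty (V ≅ intervalModule k s) := by
  classical
  have hne : ∃ v, ∃ x : Fib V v, x ≠ 0 := by
    by_contra! h
    obtain ⟨f, g, hfg⟩ := hV.nontrivial_end
    exact hfg (hom_eq_of_fibMap fun v x => (h v _).trans (h v _).symm)
  have hmin := fun m => Nat.find_min hne (m := m)
  obtain ⟨x, hx⟩ := Nat.find_spec hne
  generalize Nat.find hne = v at x hx hmin
  have hv : 1 ≤ v ∧ v ≤ n := by
    by_contra hv
    exact hx ((fib_subsingleton V hv).elim _ _)
  obtain ⟨p, rfl⟩ : ∃ p, v = p + 1 := ⟨v - 1, by omega⟩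
  have hp : ∀ y : Fib V p, y = 0 := by
    intro y
    by_contra hy
    exact hmin p (Nat.lt_succ_self p) ⟨y, hy⟩
  -- The space at `n + 1` is zero by convention, so the vector has died there at the latest.
  have hdie : ∃ q, ∃ h : p + 1 ≤ q, tr V (p + 1) q h x = 0 :=
    ⟨n + 1, by omega, (fib_subsingleton V (by omega)).elim _ _⟩
  have hqmin := fun m => Nat.find_min hdie (m := m)
  obtain ⟨hpq, hq0⟩ := Nat.find_spec hdie
  generalize Nat.find hdie = q at hpq hq0 hqmin
  have hpq' : p + 1 ≠ q := by
    rintro rfl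
    rw [tr_refl] at hq0
    exact hx hq0
  obtain ⟨q, rfl⟩ : ∃ q', q = q' + 1 := ⟨q - 1, by omega⟩
  have hy : tr V (p + 1) q (by omega) x ≠ 0 := fun h0 =>
    hqmin q (Nat.lt_succ_self q) ⟨by omega, h0⟩
  have hqn : q ≤ n := by
    by_contra hqn
    exact hy ((fib_subsingleton V (by omega)).elim _ _)
  obtain ⟨φ, hφ⟩ : ∃ φ : Module.Dual k (Fib V q), φ (tr V (p + 1) q (by omega) x) ≠ 0 := by
    by_contra! h
    exact hy ((Module.forall_dual_apply_eq_zero_iff k _).1 h)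
  let s : Strand n := ⟨⟨p, by omega⟩, ⟨q, by omega⟩, by rw [Fin.mk_lt_mk]; omega⟩
  let a : intervalModule k s ⟶ V := homFromInterval V s x hq0
  -- The scaling makes `a ≫ b` the identity. The form automatically kills the image of V_p, since
  -- V_p = 0 by the choice of the first nonzero vertex.
  let b : V ⟶ intervalModule k s :=
    homToInterval V s ((φ (tr V (p + 1) q (by omega) x))⁻¹ • φ) (fun y => by
      have hy0 : y = 0 := hp y
      rw [hy0, map_zero, map_zero])
  have hab : a ≫ b = 𝟙 _ := by
    apply hom_eq_of_form
    intro y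
    rw [formOfHom_comp]
    refine (formOfHom_homToInterval V s _ _ _).trans ?_
    rw [fibMap_homFromInterval V s x hq0 _ s.mem_top, formOfHom_apply, fibMap_id, map_smul]
    change coord s.mem_top y * ((φ (tr V (p + 1) q _ x))⁻¹ * φ (tr V (p + 1) q _ x)) = _
    rw [inv_mul_cancel₀ hφ, mul_one]
  let u : End V := b ≫ a
  have hu : u ≠ 0 := by
    intro hu
    apply id_intervalModule_ne_zero (k := k) s
    have : a ≫ (b ≫ a) ≫ b = 𝟙 _ := by
      rw [Category.assoc, hab, Category.comp_id, hab]
    rw [← this]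
    change a ≫ u ≫ b = 0
    rw [hu]
    simp
  have hiso : IsIso (b ≫ a) := (isUnit_iff_isIso u).1 (hV.isUnit_of_ne_zero u hu)
  refine ⟨s, ⟨⟨b, a, ?_, hab⟩⟩⟩
  -- An invertible idempotent is the identity.
  rw [← cancel_epi (b ≫ a), Category.comp_id, Category.assoc, ← Category.assoc a b, hab,
    Category.id_comp]

theorem isoClass_eq_iff {V W : QuiverRep k n} : isoClass V = isoClass W ↔ Nonempty (V ≅ W) :=
  Quotient.eq (r := isIsomorphicSetoid (QuiverRep k n))

theorem Strand.mem_of_iso {s t : Strand n} (e : intervalModule k s ≅ intervalModule k t) {v : ℕ}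
    (h : s.Mem v) : t.Mem v := by
  by_contra ht
  have := fib_interval_subsingleton (k := k) ht
  have h1 : fibMap (e.hom ≫ e.inv) v ((coord h).symm 1) = 0 := by
    rw [fibMap_comp, Subsingleton.elim (fibMap e.hom v _) 0, map_zero]
  rw [e.hom_inv_id, fibMap_id] at h1
  exact one_ne_zero ((LinearEquiv.map_eq_zero_iff _).1 h1)

theorem moduleClass_injective : Function.Injective (moduleClass k : Strand n → IsoClass k n) := by
  intro s t h
  obtain ⟨e⟩ := isoClass_eq_iff.1 h
  have h1 := Strand.mem_of_iso e s.mem_top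
  have h2 := Strand.mem_of_iso e.symm t.mem_top
  have h3 := Strand.mem_of_iso e s.mem_bot
  have h4 := Strand.mem_of_iso e.symm t.mem_bot
  simp only [Strand.Mem] at h1 h2 h3 h4
  ext <;> omega

/-! ### Relatively injective objects -/

theorem leftPerp_iff {V : Fin n → QuiverRep k n} {σ : Fin n → Strand n}
    (e : ∀ i, V i ≅ intervalModule k (σ i)) (i : Fin n) (W : QuiverRep k n) :
    leftPerp V i W ↔ ∀ j, j < i → Function.Bijective (tr W (σ j).i (σ j).j (σ j).le) := by
  refine forall₂_congr fun j _ => ?_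
  rw [← homExtVanish_iff]
  exact ⟨fun h => h.of_iso (Iso.refl _) (e j), fun h => h.of_iso (Iso.refl _) (e j).symm⟩

/-- A monomorphism of the perpendicular category is only tested against objects of that category.
Since the vertexwise kernel lies in it, such a monomorphism is still vertexwise injective, and
`exists_extension` applies. -/
theorem isRelativelyInjective_of_bijective {V : Fin n → QuiverRep k n} {σ : Fin n → Strand n}
    (e : ∀ i, V i ≅ intervalModule k (σ i)) (i : Fin n) (hi : leftPerp V i (V i)) {z : ℕ}
    (hz : ((σ i).j : ℕ) ≤ z)
    (h : ∀ W, leftPerp V i W → Function.Bijective (tr W (σ i).i z ((σ i).le.trans hz))) :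
    IsRelativelyInjective V i := by
  refine ⟨hi, ⟨fun {X Y} g f _ => ?_⟩⟩
  have hK : leftPerp V i (kernelRep f.hom) := by
    rw [leftPerp_iff e]
    intro j hj
    exact tr_kernelRep_bijective _ _ ((leftPerp_iff e i _).1 X.property j hj)
      ((leftPerp_iff e i _).1 Y.property j hj)
  have h0 : kernelRepι f.hom = 0 := by
    let ι : (⟨kernelRep f.hom, hK⟩ : (leftPerp V i).FullSubcategory) ⟶ X :=
      ObjectProperty.homMk (kernelRepι f.hom)
    let ζ : (⟨kernelRep f.hom, hK⟩ : (leftPerp V i).FullSubcategory) ⟶ X :=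
      ObjectProperty.homMk 0
    have h1 : ι ≫ f = ζ ≫ f := by
      apply ObjectProperty.hom_ext
      change kernelRepι f.hom ≫ f.hom = 0 ≫ f.hom
      rw [kernelRepι_comp, Limits.zero_comp]
    exact congrArg (fun a => a.hom) ((cancel_mono f).1 h1)
  obtain ⟨a, ha⟩ := exists_extension z hz (h _ X.property) (h _ Y.property) f.hom
    (fibMap_injective_of_kernel h0 _) (g.hom ≫ (e i).hom)
  refine ⟨ObjectProperty.homMk (a ≫ (e i).inv), ?_⟩
  apply ObjectProperty.hom_ext
  change f.hom ≫ a ≫ (e i).inv = g.hom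
  rw [← Category.assoc, ha, Category.assoc, Iso.hom_inv_id, Category.comp_id]

/-- Supports grow to the left from subobjects. Nothing maps back, because the structure map of the
longer module from `s.i` to `s.j` joins two vertices of its support and is onto. -/
theorem exists_mono_of_longer (s : Strand n) (y : Fin (n + 1)) (hy : y < s.i) :
    (∃ ι : intervalModule k s ⟶ intervalModule k ⟨y, s.j, hy.trans s.lt⟩, Mono ι) ∧
      ∀ g : intervalModule k ⟨y, s.j, hy.trans s.lt⟩ ⟶ intervalModule k s, g = 0 := by
  constructor
  · have h0 : ∀ x : Fib (intervalModule k s) y, x = 0 := fun x =>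
      (fib_interval_subsingleton (k := k) (v := y) (s := s) (fun h => by
        have h1 := h.1
        have h2 : (y : ℕ) < s.i := hy
        omega)).elim _ _
    refine ⟨homToInterval (intervalModule k s) ⟨y, s.j, hy.trans s.lt⟩
      (coord (k := k) s.mem_top).toLinearMap (fun x => ?_), ⟨fun {Z} g g' hg => ?_⟩⟩
    · rw [h0 x, map_zero, map_zero]
    · apply hom_eq_of_form
      intro x
      have h1 := congrArg (fun a => formOfHom (s := ⟨y, s.j, hy.trans s.lt⟩) a x) hg
      simp only [formOfHom_comp, formOfHom_homToInterval] at h1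
      exact h1
  · rw [forall_hom_eq_zero_iff]
    refine ((tr_interval_bijective _).2 ?_).2
    exact iff_of_true ⟨hy, s.le⟩ (Strand.mem_top _)

/-- Injectivity would yield a retraction of the inclusion into the longer module, but every map back
is zero. -/
theorem not_isRelativelyInjective {V : Fin n → QuiverRep k n} {σ : Fin n → Strand n}
    (e : ∀ i, V i ≅ intervalModule k (σ i)) (i : Fin n) (y : Fin (n + 1)) (hy : y < (σ i).i)
    (ht : leftPerp V i (intervalModule k ⟨y, (σ i).j, hy.trans (σ i).lt⟩)) :
    ¬ IsRelativelyInjective V i := by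
  rintro ⟨hi, hinj⟩
  obtain ⟨⟨ι, _⟩, h0⟩ := exists_mono_of_longer (k := k) (σ i) y hy
  let X : (leftPerp V i).FullSubcategory := ⟨V i, hi⟩
  let Y : (leftPerp V i).FullSubcategory := ⟨_, ht⟩
  let f : X ⟶ Y := ObjectProperty.homMk ((e i).hom ≫ ι)
  have : Mono f := by
    constructor
    intro Z g g' hg
    apply ObjectProperty.hom_ext
    rw [← cancel_mono ((e i).hom ≫ ι)]
    exact congrArg (fun a => a.hom) hg
  obtain ⟨h, hh⟩ := hinj.factors (𝟙 X) f
  have h1 : ((e i).hom ≫ ι) ≫ h.hom = 𝟙 (V i) := congrArg (fun a => a.hom) hh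
  apply id_intervalModule_ne_zero (k := k) (σ i)
  rw [← (e i).inv_hom_id, ← Category.id_comp (e i).hom, ← h1]
  have h2 := h0 (h.hom ≫ (e i).hom)
  simp only [Category.assoc]
  rw [h2]
  simp

end Exceptional

end StraightA

/-! ### Ternary trees: preorder, signs and leaf parities -/

namespace StraightA

namespace TernaryTree

variable {α : Type*}

/-- The labels of the vertices, in the order of their addresses. -/
def opts (t : TernaryTree α) : List (Option α) := t.vertices.map Prod.snd

theorem opts_node (x : α) (a b c : TernaryTree α) :
    (node x a b c).opts = some x :: (a.opts ++ (b.opts ++ c.opts)) := by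
  simp [opts, vertices, Function.comp_def]

theorem numLeaves_eq (t : TernaryTree α) : t.numLeaves = 2 * t.numNodes + 1 := by
  induction t with
  | leaf => rfl
  | node x a b c iha ihb ihc => simp only [numLeaves, numNodes]; omega

theorem numNodes_shape (t : TernaryTree α) : t.shape.numNodes = t.numNodes := by
  induction t with
  | leaf => rfl
  | node x a b c iha ihb ihc => simp only [shape, numNodes, iha, ihb, ihc]

theorem pairwise_vertices (t : TernaryTree α) :
    (t.vertices.map Prod.fst).Pairwise (· < ·) := by
  induction t with
  | leaf => simp [vertices]
  | node x a b c iha ihb ihc =>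
    have h : ∀ (i : Fin 3) (t : TernaryTree α), (t.vertices.map Prod.fst).Pairwise (· < ·) →
        (((t.vertices.map (Prod.map (List.cons i) id))).map Prod.fst).Pairwise (· < ·) := by
      intro i t ht
      rw [List.map_map]
      rw [List.pairwise_map] at ht ⊢
      refine ht.imp fun {u v} huv => ?_
      exact List.Lex.cons huv
    have h2 : ∀ (i : Fin 3) (t : TernaryTree α),
        ∀ w ∈ (t.vertices.map (Prod.map (List.cons i) id)).map Prod.fst, ∃ w', w = i :: w' := by
      intro i t w hw
      simp only [List.mem_map] at hw
      obtain ⟨_, ⟨p, _, rfl⟩, rfl⟩ := hw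
      exact ⟨p.1, rfl⟩
    simp only [vertices, List.map_cons, List.map_append]
    rw [List.pairwise_cons, List.pairwise_append, List.pairwise_append]
    refine ⟨?_, ⟨h 0 a iha, h 1 b ihb, ?_⟩, h 2 c ihc, ?_⟩
    · intro w hw
      simp only [List.mem_append] at hw
      obtain (hw | hw) | hw := hw <;> obtain ⟨w', rfl⟩ := h2 _ _ w hw <;> exact List.Lex.nil
    · intro u hu v hv
      obtain ⟨u, rfl⟩ := h2 _ _ u hu
      obtain ⟨v, rfl⟩ := h2 _ _ v hv
      exact List.Lex.rel (by decide)
    · intro u hu v hv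
      obtain ⟨v, rfl⟩ := h2 _ _ v hv
      rw [List.mem_append] at hu
      obtain hu | hu := hu <;> obtain ⟨u, rfl⟩ := h2 _ _ u hu <;> exact List.Lex.rel (by decide)

/-- The labels of the nodes in preorder, each with a sign: the root has the sign `d`, the children
`a` and `c` of a node have its sign, and the child `b` has the opposite one. -/
def signedLabels : Bool → TernaryTree α → List (α × Bool)
  | _, leaf => []
  | d, node x a b c => (x, d) :: (signedLabels d a ++ (signedLabels (!d) b ++ signedLabels d c))

/-- The labels of the nodes, in preorder. -/
def labels (t : TernaryTree α) : List α := (signedLabels true t).map Prod.fst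

theorem map_fst_signedLabels (d d' : Bool) (t : TernaryTree α) :
    (signedLabels d t).map Prod.fst = (signedLabels d' t).map Prod.fst := by
  induction t generalizing d d' with
  | leaf => rfl
  | node x a b c iha ihb ihc =>
    simp only [signedLabels, List.map_cons, List.map_append]
    rw [iha d d', ihb (!d) (!d'), ihc d d']

theorem labels_eq (d : Bool) (t : TernaryTree α) : t.labels = (signedLabels d t).map Prod.fst :=
  map_fst_signedLabels _ _ _

theorem labels_node (x : α) (a b c : TernaryTree α) :
    (node x a b c).labels = x :: (a.labels ++ (b.labels ++ c.labels)) := by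
  simp [labels, signedLabels, map_fst_signedLabels false true]

theorem length_labels (t : TernaryTree α) : t.labels.length = t.numNodes := by
  induction t with
  | leaf => rfl
  | node x a b c iha ihb ihc => simp [labels_node, numNodes, iha, ihb, ihc]; omega

theorem labels_eq_filterMap (t : TernaryTree α) : t.labels = t.opts.filterMap id := by
  induction t with
  | leaf => rfl
  | node x a b c iha ihb ihc => simp [labels_node, opts_node, iha, ihb, ihc]

end TernaryTree

/-- The nodes of a list of vertices, each with the parity of the number of leaves before it (`d` is
the parity at the beginning). -/
def leafParities {α : Type*} : Bool → List (Option α) → List (α × Bool)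
  | _, [] => []
  | d, some x :: l => (x, d) :: leafParities d l
  | d, none :: l => leafParities (!d) l

theorem leafParities_append {α : Type*} (d : Bool) (l l' : List (Option α)) :
    leafParities d (l ++ l') = leafParities d l ++
      leafParities (d ^^ decide (Odd (l.countP Option.isNone))) l' := by
  induction l generalizing d with
  | nil => simp [leafParities]
  | cons o l ih =>
    cases o with
    | some x => simp [leafParities, ih]
    | none =>
      simp only [List.cons_append, leafParities, ih, List.countP_cons, Option.isNone_none, if_true,
        Nat.odd_add_one]
      congr 2
      by_cases h : Odd (l.countP Option.isNone) <;> cases d <;> simp [h]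

theorem countP_isNone_opts {α : Type*} (t : TernaryTree α) :
    t.opts.countP Option.isNone = t.numLeaves := by
  induction t with
  | leaf => rfl
  | node x a b c iha ihb ihc => simp [TernaryTree.opts_node, TernaryTree.numLeaves, iha, ihb, ihc]; omega

/-- Every subtree has an odd number of leaves, so the parity is unchanged at child a, flipped once
before b and twice before c. These are exactly the sign rules. -/
theorem leafParities_opts {α : Type*} (d : Bool) (t : TernaryTree α) :
    leafParities d t.opts = t.signedLabels d := by
  have hodd : ∀ t : TernaryTree α, Odd (t.opts.countP Option.isNone) := fun t => by
    rw [countP_isNone_opts, t.numLeaves_eq]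
    exact ⟨_, rfl⟩
  induction t generalizing d with
  | leaf => rfl
  | node x a b c iha ihb ihc =>
    rw [TernaryTree.opts_node, leafParities, leafParities_append, leafParities_append, iha, ihb, ihc]
    simp [hodd, TernaryTree.signedLabels]

theorem mem_leafParities {α : Type*} (d : Bool) (l : List (Option α)) (m : ℕ) (x : α)
    (h : l[m]? = some (some x)) :
    (x, d ^^ decide (Odd ((l.take m).countP Option.isNone))) ∈ leafParities d l := by
  obtain ⟨hm, hx⟩ := List.getElem?_eq_some_iff.1 h
  have h1 : l = l.take m ++ (some x :: l.drop (m + 1)) := by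
    rw [← hx, List.getElem_cons_drop, List.take_append_drop]
  have h2 : leafParities d l = leafParities d (l.take m ++ (some x :: l.drop (m + 1))) :=
    congrArg _ h1
  rw [h2, leafParities_append, leafParities]
  simp

/-! ### Trees and lattice paths -/

namespace TernaryTree

variable {α : Type*}

/-- The path of a tree. -/
def word (t : TernaryTree α) : List Step := t.vertices.map fun v => stepOf v.2

theorem word_eq (t : TernaryTree α) : t.word = t.opts.map stepOf := by
  simp [word, opts, Function.comp_def]

theorem word_leaf : (leaf : TernaryTree α).word = [Step.right] := rfl

theorem word_node (x : α) (a b c : TernaryTree α) :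
    (node x a b c).word = Step.up :: (a.word ++ (b.word ++ c.word)) := by
  simp [word_eq, opts_node, stepOf]

theorem word_shape (t : TernaryTree α) : t.shape.word = t.word := by
  induction t with
  | leaf => rfl
  | node x a b c iha ihb ihc => simp only [shape, word_node, iha, ihb, ihc]

theorem count_up_word (t : TernaryTree α) : t.word.count Step.up = t.numNodes := by
  induction t with
  | leaf => rfl
  | node x a b c iha ihb ihc =>
    simp [word_node, numNodes, iha, ihb, ihc]; omega

end TernaryTree

/-- `p` is the concatenation of the paths of `m` trees, as a condition on its steps: `m` counts
the trees which still have to be read. -/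
def IsForestWord : ℕ → List Step → Prop
  | m, [] => m = 0
  | 0, _ :: _ => False
  | m + 1, Step.up :: p => IsForestWord (m + 3) p
  | m + 1, Step.right :: p => IsForestWord m p

/-- Reading a complete tree lowers the counter by exactly one: a node trades one pending tree for
three, and a leaf closes one. -/
theorem isForestWord_word_append {α : Type*} (t : TernaryTree α) (m : ℕ) (p : List Step) :
    IsForestWord (m + 1) (t.word ++ p) ↔ IsForestWord m p := by
  induction t generalizing m p with
  | leaf => rfl
  | node x a b c iha ihb ihc =>
    rw [TernaryTree.word_node, List.cons_append, IsForestWord, List.append_assoc, iha,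
      List.append_assoc, ihb, ihc]

/-- The counter equals `m` plus twice the up steps minus the right steps read so far; it must stay
positive before the end and finish at zero. -/
theorem isForestWord_iff (m : ℕ) (p : List Step) :
    IsForestWord m p ↔ 2 * p.count Step.up + m = p.count Step.right ∧
      ∀ i < p.length, (p.take i).count Step.right < 2 * (p.take i).count Step.up + m := by
  induction p generalizing m with
  | nil => simp [IsForestWord]
  | cons s p ih =>
    have hsplit : ∀ P : ℕ → Prop, (∀ i < (s :: p).length, P i) ↔
        P 0 ∧ ∀ i < p.length, P (i + 1) := by
      intro P
      constructor
      · exact fun h => ⟨h 0 (by simp), fun i hi => h (i + 1) (by simpa using hi)⟩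
      · rintro ⟨h0, h⟩ (_ | i) hi
        · exact h0
        · exact h i (by simpa using hi)
    rw [hsplit]
    cases m with
    | zero => simp [IsForestWord]
    | succ m =>
      cases s with
      | up =>
        rw [IsForestWord, ih]
        simp only [List.take_zero, List.count_nil, List.take_succ_cons, List.count_cons]
        simp
        refine and_congr (by omega) (forall₂_congr fun i _ => by omega)
      | right =>
        rw [IsForestWord, ih]
        simp only [List.take_zero, List.count_nil, List.take_succ_cons, List.count_cons]
        simp
        refine and_congr (by omega) (forall₂_congr fun i _ => by omega)

/-- The inequality x ≤ 2y is x < 2y + 1, the positivity of the counter started at one tree. -/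
theorem isLatticePath_iff (n : ℕ) (p : List Step) :
    IsLatticePath n p ↔ p.count Step.up = n ∧ IsForestWord 1 p := by
  rw [isForestWord_iff, IsLatticePath]
  simp only [pointAfter, List.take_length, Prod.mk.injEq]
  have h : ∀ a b : ℕ, a ≤ b ↔ a < b + 1 := fun a b => Nat.lt_succ_iff.symm
  simp only [h]
  constructor
  · rintro ⟨⟨h1, h2⟩, h3⟩
    exact ⟨h2, by omega, h3⟩
  · rintro ⟨h1, h2, h3⟩
    exact ⟨⟨by omega, h1⟩, h3⟩

theorem isLatticePath_word {α : Type*} (t : TernaryTree α) : IsLatticePath t.numNodes t.word := by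
  rw [isLatticePath_iff, t.count_up_word]
  refine ⟨rfl, ?_⟩
  have := isForestWord_word_append t 0 []
  rw [List.append_nil] at this
  exact this.2 rfl

/-- Words of trees form a prefix code. The arbitrary suffixes let the induction peel off the three
children one after another. -/
theorem word_append_injective (t t' : TernaryTree Unit) (p p' : List Step)
    (h : t.word ++ p = t'.word ++ p') : t = t' ∧ p = p' := by
  induction t generalizing t' p p' with
  | leaf =>
    cases t' with
    | leaf => simpa [TernaryTree.word_leaf] using h
    | node => simp [TernaryTree.word_leaf, TernaryTree.word_node] at h
  | node x a b c iha ihb ihc =>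
    cases t' with
    | leaf => simp [TernaryTree.word_leaf, TernaryTree.word_node] at h
    | node x' a' b' c' =>
      simp only [TernaryTree.word_node, List.cons_append, List.append_assoc, List.cons.injEq,
        true_and] at h
      obtain ⟨rfl, h1⟩ := iha _ _ _ h
      obtain ⟨rfl, h2⟩ := ihb _ _ _ h1
      obtain ⟨rfl, h3⟩ := ihc _ _ _ h2
      exact ⟨rfl, h3⟩

theorem word_injective : Function.Injective (TernaryTree.word : TernaryTree Unit → List Step) :=
  fun t t' h => (word_append_injective t t' [] [] (by rw [h])).1

/-- Parse the tail first: a right step prepends a leaf, and an up step joins the first three trees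
of the tail under one node. -/
theorem exists_forest (m : ℕ) (p : List Step) (h : IsForestWord m p) :
    ∃ ts : List (TernaryTree Unit), ts.length = m ∧ p = ts.flatMap TernaryTree.word := by
  induction p generalizing m with
  | nil => exact ⟨[], by simpa [IsForestWord] using h.symm, rfl⟩
  | cons s p ih =>
    cases m with
    | zero => exact h.elim
    | succ m =>
      cases s with
      | right =>
        obtain ⟨ts, hts, rfl⟩ := ih m h
        exact ⟨.leaf :: ts, by simp [hts], by simp [TernaryTree.word_leaf]⟩
      | up =>
        obtain ⟨ts, hts, rfl⟩ := ih (m + 3) h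
        obtain _ | ⟨a, _ | ⟨b, _ | ⟨c, ts⟩⟩⟩ := ts
        · simp at hts
        · simp at hts
        · simp at hts
        · refine ⟨.node () a b c :: ts, by simpa using hts, by simp [TernaryTree.word_node]⟩

theorem exists_word_eq {n : ℕ} {p : List Step} (h : IsLatticePath n p) :
    ∃ t : TernaryTree Unit, t.numNodes = n ∧ t.word = p := by
  rw [isLatticePath_iff] at h
  obtain ⟨ts, hts, rfl⟩ := exists_forest 1 p h.2
  obtain ⟨t, rfl⟩ := List.length_eq_one_iff.1 hts
  refine ⟨t, ?_, by simp⟩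
  rw [← h.1, ← t.count_up_word]
  simp

end StraightA

/-! ### Planted trees: noncrossing trees on an interval, rooted at one of its ends -/

namespace StraightA

open TernaryTree

variable {n : ℕ}

/-- `Planted d l r t`: the labels of `t` are the strands of a noncrossing tree on the vertices
`{l, …, r}` with root vertex `l` (if `d`) or `r` (otherwise), arranged as in the labelled ternary
tree of a strand diagram. -/
inductive Planted : Bool → ℕ → ℕ → TernaryTree (Strand n) → Prop
  | leaf (d : Bool) (l : ℕ) : Planted d l l .leaf
  | right {m r : ℕ} {X : Strand n} {a b c : TernaryTree (Strand n)} :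
      Planted true X.i m a → Planted false (m + 1) X.j b → Planted true X.j r c →
      Planted true X.i r (.node X a b c)
  | left {l m : ℕ} {X : Strand n} {a b c : TernaryTree (Strand n)} :
      Planted false (m + 1) X.j a → Planted true X.i m b → Planted false l X.i c →
      Planted false l X.j (.node X a b c)

namespace Planted

theorem add_numNodes {d : Bool} {l r : ℕ} {t : TernaryTree (Strand n)} (h : Planted d l r t) :
    l + t.numNodes = r := by
  induction h with
  | leaf => rfl
  | right _ _ _ iha ihb ihc => simp only [numNodes]; omega
  | left _ _ _ iha ihb ihc => simp only [numNodes]; omega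

theorem le {d : Bool} {l r : ℕ} {t : TernaryTree (Strand n)} (h : Planted d l r t) : l ≤ r := by
  have := h.add_numNodes
  omega

/-- A subtree with N nodes occupies N + 1 consecutive vertices, so the node counts of the children
dictate the endpoints of the root strand. -/
theorem exists_of_shape (s : TernaryTree Unit) (d : Bool) (l : ℕ) (h : l + s.numNodes ≤ n) :
    ∃ t : TernaryTree (Strand n), Planted d l (l + s.numNodes) t ∧ t.shape = s := by
  induction s generalizing d l with
  | leaf => exact ⟨.leaf, .leaf d l, rfl⟩
  | node x a b c iha ihb ihc =>
    simp only [numNodes] at h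
    cases d with
    | true =>
      let X : Strand n := ⟨⟨l, by omega⟩, ⟨l + a.numNodes + 1 + b.numNodes, by omega⟩, by
        rw [Fin.mk_lt_mk]; omega⟩
      obtain ⟨ta, ha, rfl⟩ := iha true l (by omega)
      obtain ⟨tb, hb, rfl⟩ := ihb false (l + ta.shape.numNodes + 1) (by omega)
      obtain ⟨tc, hc, rfl⟩ := ihc true X.j (by dsimp only [X]; omega)
      refine ⟨.node X ta tb tc, ?_, rfl⟩
      convert Planted.right (X := X) ha hb hc using 1
      simp only [numNodes, X]; omega
    | false =>
      let X : Strand n := ⟨⟨l + c.numNodes, by omega⟩,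
        ⟨l + c.numNodes + b.numNodes + 1 + a.numNodes, by omega⟩, by
        rw [Fin.mk_lt_mk]; omega⟩
      obtain ⟨tc, hc, rfl⟩ := ihc false l (by omega)
      obtain ⟨tb, hb, rfl⟩ := ihb true X.i (by dsimp only [X]; omega)
      obtain ⟨ta, ha, rfl⟩ := iha false (X.i + tb.shape.numNodes + 1) (by dsimp only [X]; omega)
      refine ⟨.node X ta tb tc, ?_, rfl⟩
      convert Planted.left (X := X) (l := l) (m := X.i + tb.shape.numNodes) ha hb hc using 1
      simp only [numNodes, X]; omega

/-- Node counts recover all endpoints from the left end of the interval, so agreement of the left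
ends suffices. -/
theorem eq_of_shape {d : Bool} {l r l' r' : ℕ} {t t' : TernaryTree (Strand n)}
    (h : Planted d l r t) (h' : Planted d l' r' t') (hroot : l = l')
    (hs : t.shape = t'.shape) : t = t' := by
  induction h generalizing l' r' t' with
  | leaf => cases h' <;> simp_all [shape]
  | @right m r X a b c ha hb hc iha ihb ihc =>
    cases h' with
    | leaf => simp [shape] at hs
    | @right m' r' X' a' b' c' ha' hb' hc' =>
      simp only [shape, node.injEq, true_and] at hs
      obtain ⟨h1, h2, h3⟩ := hs
      have e1 := congrArg numNodes h1
      have e2 := congrArg numNodes h2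
      simp only [numNodes_shape] at e1 e2
      have := ha.add_numNodes; have := hb.add_numNodes
      have := ha'.add_numNodes; have := hb'.add_numNodes
      have hX : X = X' := by ext <;> omega
      subst hX
      rw [iha ha' rfl h1, ihb hb' (by omega) h2, ihc hc' rfl h3]
  | @left l m X a b c ha hb hc iha ihb ihc =>
    cases h' with
    | leaf => simp [shape] at hs
    | @left _ m' X' a' b' c' ha' hb' hc' =>
      simp only [shape, node.injEq, true_and] at hs
      obtain ⟨h1, h2, h3⟩ := hs
      have e1 := congrArg numNodes h1
      have e2 := congrArg numNodes h2
      have e3 := congrArg numNodes h3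
      simp only [numNodes_shape] at e1 e2 e3
      have := ha.add_numNodes; have := hb.add_numNodes; have := hc.add_numNodes
      have := ha'.add_numNodes; have := hb'.add_numNodes; have := hc'.add_numNodes
      have hX : X = X' := by ext <;> omega
      subst hX
      rw [iha ha' (by omega) h1, ihb hb' rfl h2, ihc hc' hroot h3]

theorem bounds {d : Bool} {l r : ℕ} {t : TernaryTree (Strand n)} (h : Planted d l r t) :
    ∀ s ∈ t.labels, l ≤ s.i ∧ (s.j : ℕ) ≤ r := by
  induction h with
  | leaf => simp [labels, signedLabels]
  | @right m r X a b c ha hb hc iha ihb ihc =>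
    intro s hs
    have := ha.le; have := hb.le; have := hc.le; have := X.le
    simp only [labels_node, List.mem_cons, List.mem_append] at hs
    obtain rfl | hs | hs | hs := hs
    · omega
    · have := iha s hs; omega
    · have := ihb s hs; omega
    · have := ihc s hs; omega
  | @left l m X a b c ha hb hc iha ihb ihc =>
    intro s hs
    have := ha.le; have := hb.le; have := hc.le; have := X.le
    simp only [labels_node, List.mem_cons, List.mem_append] at hs
    obtain rfl | hs | hs | hs := hs
    · omega
    · have := iha s hs; omega
    · have := ihb s hs; omega
    · have := ihc s hs; omega

/-- The strands of a planted tree can be ordered into an exceptional sequence. -/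
theorem exists_ordering {d : Bool} {l r : ℕ} {t : TernaryTree (Strand n)} (h : Planted d l r t) :
    ∃ L : List (Strand n), L.Perm t.labels ∧ L.Pairwise Prec := by
  induction h with
  | leaf => exact ⟨[], by simp [labels, signedLabels], List.Pairwise.nil⟩
  | @right m r X a b c ha hb hc iha ihb ihc =>
    obtain ⟨La, pa, oa⟩ := iha
    obtain ⟨Lb, pb, ob⟩ := ihb
    obtain ⟨Lc, pc, oc⟩ := ihc
    have := ha.le; have := hb.le; have := hc.le; have := X.le
    have ba := fun s (hs : s ∈ La) => ha.bounds s (pa.mem_iff.1 hs)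
    have bb := fun s (hs : s ∈ Lb) => hb.bounds s (pb.mem_iff.1 hs)
    have bc := fun s (hs : s ∈ Lc) => hc.bounds s (pc.mem_iff.1 hs)
    -- Strands of b lie inside the support of X, with left end greater than `X.i`, and must precede
    -- X. Those of a share the root vertex or lie inside, and those of c lie beyond; all of these
    -- may follow X.
    refine ⟨Lb ++ X :: (La ++ Lc), ?_, ?_⟩
    · rw [labels_node]
      refine List.perm_middle.trans (List.Perm.cons X ?_)
      refine List.perm_append_comm_assoc _ _ _ |>.trans ?_
      exact pa.append (pb.append pc)
    · simp only [List.pairwise_append, List.pairwise_cons, List.mem_cons, List.mem_append]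
      refine ⟨ob, ⟨?_, oa, oc, ?_⟩, ?_⟩
      · rintro s (hs | hs)
        · have := ba s hs; have := s.lt; simp only [Prec, Strand.Mem]; omega
        · have := bc s hs; have := s.lt; simp only [Prec, Strand.Mem]; omega
      · intro s hs s' hs'
        have := ba s hs; have := bc s' hs'; have := s.lt; have := s'.lt
        simp only [Prec, Strand.Mem]; omega
      · rintro s hs s' (rfl | hs' | hs')
        · have := bb s hs; have := s.lt; simp only [Prec, Strand.Mem]; omega
        · have := bb s hs; have := ba s' hs'; have := s.lt; have := s'.lt
          simp only [Prec, Strand.Mem]; omega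
        · have := bb s hs; have := bc s' hs'; have := s.lt; have := s'.lt
          simp only [Prec, Strand.Mem]; omega
  | @left l m X a b c ha hb hc iha ihb ihc =>
    obtain ⟨La, pa, oa⟩ := iha
    obtain ⟨Lb, pb, ob⟩ := ihb
    obtain ⟨Lc, pc, oc⟩ := ihc
    have := ha.le; have := hb.le; have := hc.le; have := X.le
    have ba := fun s (hs : s ∈ La) => ha.bounds s (pa.mem_iff.1 hs)
    have bb := fun s (hs : s ∈ Lb) => hb.bounds s (pb.mem_iff.1 hs)
    have bc := fun s (hs : s ∈ Lc) => hc.bounds s (pc.mem_iff.1 hs)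
    -- For a left-oriented X the roles are mirrored: b follows X, while a and c precede it.
    refine ⟨(Lc ++ La) ++ X :: Lb, ?_, ?_⟩
    · rw [labels_node]
      refine List.perm_middle.trans (List.Perm.cons X ?_)
      refine List.perm_append_comm.trans ?_
      refine (List.perm_append_comm_assoc _ _ _).trans ?_
      refine (List.Perm.append_left Lc List.perm_append_comm).trans ?_
      refine (List.perm_append_comm).trans ?_
      rw [List.append_assoc]
      exact pa.append (pb.append pc)
    · simp only [List.pairwise_append, List.pairwise_cons, List.mem_cons, List.mem_append]
      refine ⟨⟨oc, oa, ?_⟩, ⟨?_, ob⟩, ?_⟩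
      · intro s hs s' hs'
        have := bc s hs; have := ba s' hs'; have := s.lt; have := s'.lt
        simp only [Prec, Strand.Mem]; omega
      · intro s hs
        have := bb s hs; have := s.lt; simp only [Prec, Strand.Mem]; omega
      · rintro s (hs | hs) s' (rfl | hs')
        · have := bc s hs; have := s.lt; simp only [Prec, Strand.Mem]; omega
        · have := bc s hs; have := bb s' hs'; have := s.lt; have := s'.lt
          simp only [Prec, Strand.Mem]; omega
        · have := ba s hs; have := s.lt; simp only [Prec, Strand.Mem]; omega
        · have := ba s hs; have := bb s' hs'; have := s.lt; have := s'.lt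
          simp only [Prec, Strand.Mem]; omega

theorem not_prec_self (s : Strand n) : ¬ Prec s s := by
  have := s.lt
  simp only [Prec, Strand.Mem]; omega

theorem nodup_labels {d : Bool} {l r : ℕ} {t : TernaryTree (Strand n)} (h : Planted d l r t) :
    t.labels.Nodup := by
  obtain ⟨L, hL, hP⟩ := h.exists_ordering
  rw [← hL.nodup_iff]
  refine hP.imp fun {a b} hab => ?_
  rintro rfl
  exact not_prec_self _ hab

end Planted

end StraightA

/-! ### Orientation by distance, and agreement with the greedily grown tree -/

namespace StraightA

open TernaryTree

variable {n : ℕ}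

/-- The distance from a vertex of a graph is determined by its local behaviour. -/
theorem dist_eq_of_depth {V : Type*} (G : SimpleGraph V) (o : V) (h : V → ℕ) (h0 : h o = 0)
    (hadj : ∀ u v, G.Adj u v → h v ≤ h u + 1)
    (hdown : ∀ v, v ≠ o → ∃ u, G.Adj u v ∧ h v = h u + 1) (v : V) : G.dist o v = h v := by
  have hw : ∀ m v, h v = m → ∃ p : G.Walk o v, p.length = m := by
    intro m
    induction m with
    | zero =>
      intro v hv
      by_cases hvo : v = o
      · subst hvo
        exact ⟨.nil, rfl⟩
      · obtain ⟨u, _, hu⟩ := hdown v hvo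
        omega
    | succ m ih =>
      intro v hv
      obtain ⟨u, hu, hvu⟩ := hdown v (by rintro rfl; omega)
      obtain ⟨p, hp⟩ := ih u (by omega)
      exact ⟨p.concat hu, by rw [SimpleGraph.Walk.length_concat, hp]⟩
  have hle : ∀ u v (p : G.Walk u v), h v ≤ h u + p.length := by
    intro u v p
    induction p with
    | nil => simp
    | cons huv p ih =>
      have := hadj _ _ huv
      rw [SimpleGraph.Walk.length_cons]
      omega
  obtain ⟨p, hp⟩ := hw _ v rfl
  apply le_antisymm
  · rw [← hp]
    exact SimpleGraph.dist_le p
  · obtain ⟨q, hq⟩ := p.reachable.exists_walk_length_eq_dist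
    have := hle _ _ q
    omega

/-- The root vertex of a noncrossing tree on `{l, …, r}`. -/
def rootVertex (d : Bool) (l r : ℕ) : ℕ := if d then l else r

/-- The vertices of `{l, …, r}` other than the root vertex. -/
def Inner (d : Bool) (l r v : ℕ) : Prop := l ≤ v ∧ v ≤ r ∧ v ≠ rootVertex d l r

theorem mem_labels_of_mem_signedLabels {α : Type*} {d : Bool} {t : TernaryTree α} {p : α × Bool}
    (h : p ∈ t.signedLabels d) : p.1 ∈ t.labels := by
  rw [labels_eq d]
  exact List.mem_map_of_mem h

theorem exists_mem_signedLabels {α : Type*} (d : Bool) {t : TernaryTree α} {s : α}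
    (h : s ∈ t.labels) : ∃ e, (s, e) ∈ t.signedLabels d := by
  rw [labels_eq d, List.mem_map] at h
  obtain ⟨⟨s, e⟩, h, rfl⟩ := h
  exact ⟨e, h⟩

/-- The endpoint of a strand far from the root vertex, according to its sign. -/
def farEnd (p : Strand n × Bool) : ℕ := if p.2 then p.1.j else p.1.i

/-- The endpoint of a strand close to the root vertex, according to its sign. -/
def nearEnd (p : Strand n × Bool) : ℕ := if p.2 then p.1.i else p.1.j

namespace Planted

theorem ends_bounds {d : Bool} {l r : ℕ} {t : TernaryTree (Strand n)} (h : Planted d l r t)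
    {d' : Bool} : ∀ p ∈ t.signedLabels d', l ≤ farEnd p ∧ farEnd p ≤ r ∧ l ≤ nearEnd p ∧
      nearEnd p ≤ r := by
  intro p hp
  have h1 := h.bounds _ (mem_labels_of_mem_signedLabels hp)
  have h2 := p.1.le
  simp only [farEnd, nearEnd]
  split_ifs <;> omega

/-- The depth functions of the children are glued. The subtree a keeps the root depth, while b and c
both start one deeper at the far end of the root strand, the only vertex they share. -/
theorem exists_depth {d : Bool} {l r : ℕ} {t : TernaryTree (Strand n)} (h : Planted d l r t) :
    ∀ h0 : ℕ, ∃ h : ℕ → ℕ, h (rootVertex d l r) = h0 ∧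
      ∀ p ∈ t.signedLabels d, h (farEnd p) = h (nearEnd p) + 1 := by
  induction h with
  | leaf d l => exact fun h0 => ⟨fun _ => h0, rfl, by simp [signedLabels]⟩
  | @right m r X a b c ha hb hc iha ihb ihc =>
    intro h0
    obtain ⟨fa, ra, ea⟩ := iha h0
    obtain ⟨fb, rb, eb⟩ := ihb (h0 + 1)
    obtain ⟨fc, rc, ec⟩ := ihc (h0 + 1)
    have := ha.le; have := hb.le; have := hc.le
    simp only [rootVertex, if_true, Bool.false_eq_true, if_false] at ra rb rc ⊢
    let f : ℕ → ℕ := fun v => if v ≤ m then fa v else if v ≤ X.j then fb v else fc v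
    have fA : ∀ v, v ≤ m → f v = fa v := fun v hv => if_pos hv
    have fB : ∀ v : ℕ, m + 1 ≤ v → v ≤ X.j → f v = fb v := fun v hv hv' => by
      simp only [f]; rw [if_neg (by omega), if_pos hv']
    have fC : ∀ v : ℕ, X.j ≤ v → f v = fc v := fun v hv => by
      simp only [f]
      rw [if_neg (by omega)]
      split_ifs with h1
      · have : v = X.j := by omega
        rw [this, rb, rc]
      · rfl
    refine ⟨f, by rw [fA _ (by omega), ra], ?_⟩
    intro p hp
    simp only [signedLabels, List.mem_cons, List.mem_append, Bool.not_true] at hp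
    obtain rfl | hp | hp | hp := hp
    · simp only [farEnd, nearEnd, if_true]
      rw [fB _ (by omega) le_rfl, fA _ (by omega), ra, rb]
    · have := ha.ends_bounds p hp
      rw [fA _ (by omega), fA _ (by omega), ea p hp]
    · have := hb.ends_bounds p hp
      rw [fB _ (by omega) (by omega), fB _ (by omega) (by omega), eb p hp]
    · have := hc.ends_bounds p hp
      rw [fC _ (by omega), fC _ (by omega), ec p hp]
  | @left l m X a b c ha hb hc iha ihb ihc =>
    intro h0
    obtain ⟨fa, ra, ea⟩ := iha h0
    obtain ⟨fb, rb, eb⟩ := ihb (h0 + 1)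
    obtain ⟨fc, rc, ec⟩ := ihc (h0 + 1)
    have := ha.le; have := hb.le; have := hc.le
    simp only [rootVertex, if_true, Bool.false_eq_true, if_false] at ra rb rc ⊢
    let f : ℕ → ℕ := fun v => if m < v then fa v else if X.i ≤ v then fb v else fc v
    have fA : ∀ v, m < v → f v = fa v := fun v hv => if_pos hv
    have fB : ∀ v : ℕ, X.i ≤ v → v ≤ m → f v = fb v := fun v hv hv' => by
      simp only [f]; rw [if_neg (by omega), if_pos hv]
    have fC : ∀ v : ℕ, v ≤ X.i → f v = fc v := fun v hv => by
      simp only [f]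
      rw [if_neg (by omega)]
      split_ifs with h1
      · have : v = X.i := by omega
        rw [this, rb, rc]
      · rfl
    refine ⟨f, by rw [fA _ (by omega), ra], ?_⟩
    intro p hp
    simp only [signedLabels, List.mem_cons, List.mem_append, Bool.not_false] at hp
    obtain rfl | hp | hp | hp := hp
    · simp only [farEnd, nearEnd, Bool.false_eq_true, if_false]
      rw [fB _ le_rfl (by omega), fA _ (by omega), ra, rb]
    · have := ha.ends_bounds p hp
      rw [fA _ (by omega), fA _ (by omega), ea p hp]
    · have := hb.ends_bounds p hp
      rw [fB _ (by omega) (by omega), fB _ (by omega) (by omega), eb p hp]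
    · have := hc.ends_bounds p hp
      rw [fC _ (by omega), fC _ (by omega), ec p hp]

/-- This provides, for each non-root vertex, the neighbour one step closer to the root that
`dist_eq_of_depth` needs. -/
theorem exists_farEnd {d : Bool} {l r : ℕ} {t : TernaryTree (Strand n)} (h : Planted d l r t) :
    ∀ v, Inner d l r v → ∃ p ∈ t.signedLabels d, farEnd p = v := by
  induction h with
  | leaf d l =>
    intro v hv
    obtain ⟨h1, h2, h3⟩ := hv
    simp only [rootVertex] at h3
    split_ifs at h3 <;> omega
  | @right m r X a b c ha hb hc iha ihb ihc =>
    intro v hv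
    simp only [Inner, rootVertex, if_true, Bool.false_eq_true, if_false] at hv iha ihb ihc
    have := ha.le; have := hb.le; have := hc.le
    simp only [signedLabels, List.mem_cons, List.mem_append, Bool.not_true]
    by_cases h1 : v ≤ m
    · obtain ⟨p, hp, rfl⟩ := iha v (by omega)
      exact ⟨p, by tauto, rfl⟩
    · by_cases h2 : v = X.j
      · exact ⟨(X, true), by tauto, h2.symm⟩
      · by_cases h3 : v < X.j
        · obtain ⟨p, hp, rfl⟩ := ihb v (by omega)
          exact ⟨p, by tauto, rfl⟩
        · obtain ⟨p, hp, rfl⟩ := ihc v (by omega)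
          exact ⟨p, by tauto, rfl⟩
  | @left l m X a b c ha hb hc iha ihb ihc =>
    intro v hv
    simp only [Inner, rootVertex, if_true, Bool.false_eq_true, if_false] at hv iha ihb ihc
    have := ha.le; have := hb.le; have := hc.le
    simp only [signedLabels, List.mem_cons, List.mem_append, Bool.not_false]
    by_cases h1 : m < v
    · obtain ⟨p, hp, rfl⟩ := iha v (by omega)
      exact ⟨p, by tauto, rfl⟩
    · by_cases h2 : v = X.i
      · exact ⟨(X, false), by tauto, h2.symm⟩
      · by_cases h3 : X.i < v
        · obtain ⟨p, hp, rfl⟩ := ihb v (by omega)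
          exact ⟨p, by tauto, rfl⟩
        · obtain ⟨p, hp, rfl⟩ := ihc v (by omega)
          exact ⟨p, by tauto, rfl⟩

/-- The strands of the diagram of a planted tree are oriented according to their signs. -/
theorem oriented {t : TernaryTree (Strand n)} (h : Planted true 0 n t) :
    ∀ p ∈ t.signedLabels true, if p.2 then OrientedRight {s | s ∈ t.labels} p.1
      else OrientedLeft {s | s ∈ t.labels} p.1 := by
  obtain ⟨f, f0, hf⟩ := h.exists_depth 0
  have hdist : ∀ v : Fin (n + 1), (strandGraph {s | s ∈ t.labels}).dist 0 v = f v := by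
    refine dist_eq_of_depth _ 0 (fun v : Fin (n + 1) => f v) f0 ?_ ?_
    · have key : ∀ u v : Fin (n + 1), (∃ s ∈ {s | s ∈ t.labels}, s.i = u ∧ s.j = v) →
          f v ≤ f u + 1 ∧ f u ≤ f v + 1 := by
        rintro u v ⟨s, hs, rfl, rfl⟩
        obtain ⟨e, he⟩ := exists_mem_signedLabels true hs
        have := hf _ he
        simp only [farEnd, nearEnd] at this
        split_ifs at this <;> omega
      intro u v huv
      rw [strandGraph, SimpleGraph.fromRel_adj] at huv
      obtain ⟨_, huv | huv⟩ := huv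
      · exact (key _ _ huv).1
      · exact (key _ _ huv).2
    · intro v hv
      have hv' : (v : ℕ) ≠ 0 := fun h0 => hv (Fin.ext h0)
      obtain ⟨⟨s, e⟩, hp, hpv⟩ := h.exists_farEnd v
        ⟨Nat.zero_le _, by omega, by simpa [rootVertex] using hv'⟩
      have hs := mem_labels_of_mem_signedLabels hp
      have hd := hf _ hp
      have hne := s.lt.ne
      cases e with
      | true =>
        have : s.j = v := Fin.ext hpv
        subst this
        refine ⟨s.i, ?_, hd⟩
        rw [strandGraph, SimpleGraph.fromRel_adj]
        exact ⟨hne, Or.inl ⟨s, hs, rfl, rfl⟩⟩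
      | false =>
        have : s.i = v := Fin.ext hpv
        subst this
        refine ⟨s.j, ?_, hd⟩
        rw [strandGraph, SimpleGraph.fromRel_adj]
        exact ⟨hne.symm, Or.inr ⟨s, hs, rfl, rfl⟩⟩
  rintro ⟨s, e⟩ hp
  have hd := hf _ hp
  cases e with
  | true =>
    simp only [if_true, OrientedRight, hdist]
    simp only [farEnd, nearEnd, if_true] at hd
    omega
  | false =>
    simp only [Bool.false_eq_true, if_false, OrientedLeft, hdist]
    simp only [farEnd, nearEnd, Bool.false_eq_true, if_false] at hd
    omega

/-- A planted tree is obtained from a diagram which contains its labels as the strands at the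
vertices other than the root vertex. -/
theorem isGrownFrom {D : Set (Strand n)} {d : Bool} {l r : ℕ} {t : TernaryTree (Strand n)}
    (h : Planted d l r t) (hsub : ∀ s ∈ t.labels, s ∈ D)
    (hori : ∀ p ∈ t.signedLabels d, if p.2 then OrientedRight D p.1 else OrientedLeft D p.1)
    (hloc : ∀ s ∈ D, (Inner d l r s.i ∨ Inner d l r s.j) → s ∈ t.labels) (C : Set (Strand n))
    (hC : ∀ s, s ∈ C ↔ s ∈ t.labels ∧ nearEnd (s, d) = rootVertex d l r) :
    t.IsGrownFrom D C := by
  induction h generalizing C with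
  | leaf d l =>
    simp only [labels, signedLabels, List.map_nil, List.not_mem_nil, false_and, iff_false] at hC
    exact Set.eq_empty_iff_forall_notMem.2 hC
  | @right m r X a b c ha hb hc iha ihb ihc =>
    have := ha.le; have := hb.le; have := hc.le
    have ba := ha.bounds; have bb := hb.bounds; have bc := hc.bounds
    have hX : OrientedRight D X := hori (X, true) (by simp [signedLabels])
    have hX' : ¬ OrientedLeft D X := lt_asymm hX
    simp only [signedLabels, List.mem_cons, List.mem_append, Bool.not_true] at hori
    simp only [labels_node, List.mem_cons, List.mem_append] at hsub hloc hC
    simp only [Inner, rootVertex, if_true, Bool.false_eq_true, if_false, nearEnd] at hloc hC iha ihb ihc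
    refine ⟨⟨(hC X).2 ⟨Or.inl rfl, rfl⟩, ?_⟩, ?_, ?_, ?_⟩
    · intro s hs
      obtain ⟨hs, hsi⟩ := (hC s).1 hs
      have := s.lt
      refine ⟨show X.i ≤ s.i from ?_, show s.j ≤ X.j from ?_⟩
      · omega
      · obtain rfl | hs | hs | hs := hs
        · exact le_rfl
        · have := ba s hs; omega
        · have := bb s hs; omega
        · have := bc s hs; omega
    · refine iha (fun s hs => hsub s (Or.inr (Or.inl hs)))
        (fun p hp => hori p (Or.inr (Or.inl hp))) ?_ _ ?_
      · intro s hs hin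
        have := s.lt
        obtain rfl | h | h | h := hloc s hs (by omega)
        · omega
        · exact h
        · have := bb s h; omega
        · have := bc s h; omega
      · intro s
        simp only [aCandidates, Set.mem_ofPred_eq, hX, hX', true_and, false_and, or_false]
        have := s.lt
        constructor
        · rintro ⟨hs, h1, h2⟩
          obtain rfl | h | h | h := hloc s hs (by omega)
          · omega
          · exact ⟨h, by omega⟩
          · have := bb s h; omega
          · have := bc s h; omega
        · rintro ⟨hs, h1⟩
          have := ba s hs
          exact ⟨hsub s (Or.inr (Or.inl hs)), by omega, by omega⟩
    · refine ihb (fun s hs => hsub s (Or.inr (Or.inr (Or.inl hs))))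
        (fun p hp => hori p (Or.inr (Or.inr (Or.inl hp)))) ?_ _ ?_
      · intro s hs hin
        have := s.lt
        obtain rfl | h | h | h := hloc s hs (by omega)
        · omega
        · have := ba s h; omega
        · exact h
        · have := bc s h; omega
      · intro s
        simp only [bCandidates, Set.mem_ofPred_eq, hX, hX', true_and, false_and, or_false]
        have := s.lt
        constructor
        · rintro ⟨hs, h1, h2⟩
          obtain rfl | h | h | h := hloc s hs (by omega)
          · omega
          · have := ba s h; omega
          · exact ⟨h, by omega⟩
          · have := bc s h; omega
        · rintro ⟨hs, h1⟩
          have := bb s hs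
          exact ⟨hsub s (Or.inr (Or.inr (Or.inl hs))), by omega, by omega⟩
    · refine ihc (fun s hs => hsub s (Or.inr (Or.inr (Or.inr hs))))
        (fun p hp => hori p (Or.inr (Or.inr (Or.inr hp)))) ?_ _ ?_
      · intro s hs hin
        have := s.lt
        obtain rfl | h | h | h := hloc s hs (by omega)
        · omega
        · have := ba s h; omega
        · have := bb s h; omega
        · exact h
      · intro s
        simp only [cCandidates, Set.mem_ofPred_eq, hX, hX', true_and, false_and, or_false]
        have := s.lt
        constructor
        · rintro ⟨hs, h1⟩
          obtain rfl | h | h | h := hloc s hs (by omega)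
          · omega
          · have := ba s h; omega
          · have := bb s h; omega
          · exact ⟨h, by omega⟩
        · rintro ⟨hs, h1⟩
          have := bc s hs
          exact ⟨hsub s (Or.inr (Or.inr (Or.inr hs))), by omega⟩
  | @left l m X a b c ha hb hc iha ihb ihc =>
    have := ha.le; have := hb.le; have := hc.le
    have ba := ha.bounds; have bb := hb.bounds; have bc := hc.bounds
    have hX : OrientedLeft D X := hori (X, false) (by simp [signedLabels])
    have hX' : ¬ OrientedRight D X := lt_asymm hX
    simp only [signedLabels, List.mem_cons, List.mem_append, Bool.not_false] at hori
    simp only [labels_node, List.mem_cons, List.mem_append] at hsub hloc hC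
    simp only [Inner, rootVertex, if_true, Bool.false_eq_true, if_false, nearEnd] at hloc hC iha ihb ihc
    refine ⟨⟨(hC X).2 ⟨Or.inl rfl, rfl⟩, ?_⟩, ?_, ?_, ?_⟩
    · intro s hs
      obtain ⟨hs, hsi⟩ := (hC s).1 hs
      have := s.lt
      refine ⟨show X.i ≤ s.i from ?_, show s.j ≤ X.j from ?_⟩
      · obtain rfl | hs | hs | hs := hs
        · exact le_rfl
        · have := ba s hs; omega
        · have := bb s hs; omega
        · have := bc s hs; omega
      · omega
    · refine iha (fun s hs => hsub s (Or.inr (Or.inl hs)))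
        (fun p hp => hori p (Or.inr (Or.inl hp))) ?_ _ ?_
      · intro s hs hin
        have := s.lt
        obtain rfl | h | h | h := hloc s hs (by omega)
        · omega
        · exact h
        · have := bb s h; omega
        · have := bc s h; omega
      · intro s
        simp only [aCandidates, Set.mem_ofPred_eq, hX, hX', true_and, false_and, false_or]
        have := s.lt
        constructor
        · rintro ⟨hs, h1, h2⟩
          obtain rfl | h | h | h := hloc s hs (by omega)
          · omega
          · exact ⟨h, by omega⟩
          · have := bb s h; omega
          · have := bc s h; omega
        · rintro ⟨hs, h1⟩
          have := ba s hs
          exact ⟨hsub s (Or.inr (Or.inl hs)), by omega, by omega⟩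
    · refine ihb (fun s hs => hsub s (Or.inr (Or.inr (Or.inl hs))))
        (fun p hp => hori p (Or.inr (Or.inr (Or.inl hp)))) ?_ _ ?_
      · intro s hs hin
        have := s.lt
        obtain rfl | h | h | h := hloc s hs (by omega)
        · omega
        · have := ba s h; omega
        · exact h
        · have := bc s h; omega
      · intro s
        simp only [bCandidates, Set.mem_ofPred_eq, hX, hX', true_and, false_and, false_or]
        have := s.lt
        constructor
        · rintro ⟨hs, h1, h2⟩
          obtain rfl | h | h | h := hloc s hs (by omega)
          · omega
          · have := ba s h; omega
          · exact ⟨h, by omega⟩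
          · have := bc s h; omega
        · rintro ⟨hs, h1⟩
          have := bb s hs
          exact ⟨hsub s (Or.inr (Or.inr (Or.inl hs))), by omega, by omega⟩
    · refine ihc (fun s hs => hsub s (Or.inr (Or.inr (Or.inr hs))))
        (fun p hp => hori p (Or.inr (Or.inr (Or.inr hp)))) ?_ _ ?_
      · intro s hs hin
        have := s.lt
        obtain rfl | h | h | h := hloc s hs (by omega)
        · omega
        · have := ba s h; omega
        · have := bb s h; omega
        · exact h
      · intro s
        simp only [cCandidates, Set.mem_ofPred_eq, hX, hX', true_and, false_and, false_or]
        have := s.lt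
        constructor
        · rintro ⟨hs, h1⟩
          obtain rfl | h | h | h := hloc s hs (by omega)
          · omega
          · have := ba s h; omega
          · have := bb s h; omega
          · exact ⟨h, by omega⟩
        · rintro ⟨hs, h1⟩
          have := bc s hs
          exact ⟨hsub s (Or.inr (Or.inr (Or.inr hs))), by omega⟩

theorem isTreeOf {t : TernaryTree (Strand n)} (h : Planted true 0 n t) :
    t.IsTreeOf {s | s ∈ t.labels} := by
  refine h.isGrownFrom (fun s hs => hs) h.oriented (fun s hs _ => hs) _ fun s => ?_
  simp only [rootCandidates, Set.mem_ofPred_eq, nearEnd, rootVertex, if_true]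
  refine and_congr_right fun _ => ⟨fun h => by simp [h], fun h => Fin.ext h⟩

end Planted

theorem strand_le_antisymm {s t : Strand n} (h : s ≤ t) (h' : t ≤ s) : s = t :=
  Strand.ext (le_antisymm h'.1 h.1) (le_antisymm h.2 h'.2)

/-- Inclusion of supports is antisymmetric, so the greatest candidate is unique at each node and in
turn determines the candidates of its children. -/
theorem isGrownFrom_unique {D C : Set (Strand n)} {t t' : TernaryTree (Strand n)}
    (h : t.IsGrownFrom D C) (h' : t'.IsGrownFrom D C) : t = t' := by
  induction t generalizing C t' with
  | leaf =>
    cases t' with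
    | leaf => rfl
    | node X a b c =>
      have h1 : C = ∅ := h
      exact absurd h'.1.1 (by simp [h1])
  | node X a b c iha ihb ihc =>
    cases t' with
    | leaf =>
      have h1 : C = ∅ := h'
      exact absurd h.1.1 (by simp [h1])
    | node X' a' b' c' =>
      have hX : X = X' := strand_le_antisymm (h'.1.2 h.1.1) (h.1.2 h'.1.1)
      subst hX
      rw [iha h.2.1 h'.2.1, ihb h.2.2.1 h'.2.2.1, ihc h.2.2.2 h'.2.2.2]

end StraightA

/-! ### Full exceptional sets of strands are label sets of planted trees -/

namespace StraightA

open TernaryTree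

variable {n : ℕ}

/-- The positions `pos` order the strands in `D` into an exceptional sequence. -/
def Ordered (pos : Strand n → ℤ) (D : Finset (Strand n)) : Prop :=
  ∀ s ∈ D, ∀ t ∈ D, s ≠ t → (pos s < pos t ∧ Prec s t) ∨ (pos t < pos s ∧ Prec t s)

theorem Ordered.mono {pos : Strand n → ℤ} {D D' : Finset (Strand n)} (h : Ordered pos D)
    (hD : D' ⊆ D) : Ordered pos D' :=
  fun s hs t ht => h s (hD hs) t (hD ht)

open Classical in
/-- The dimension vectors of an exceptional sequence are linearly independent. -/
theorem Ordered.card_le {pos : Strand n → ℤ} {D : Finset (Strand n)} (h : Ordered pos D)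
    {l r : ℕ} (hD : ∀ s ∈ D, l ≤ s.i ∧ (s.j : ℕ) ≤ r) : D.card ≤ r - l := by
  let vec : D → (Finset.Ioc l r → ℚ) := fun s v => if s.1.Mem v then 1 else 0
  have hli : LinearIndependent ℚ vec := by
    rw [Fintype.linearIndependent_iff]
    intro g hg
    by_contra! hne
    have hS : (Finset.univ.filter fun s => g s ≠ 0).Nonempty := by
      obtain ⟨s, hs⟩ := hne
      exact ⟨s, by simpa using hs⟩
    -- The earliest strand with nonzero coefficient in a linear relation.
    obtain ⟨s, hs, hmin⟩ := Finset.exists_min_image _ (fun s : D => pos s.1) hS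
    have hx : ∀ v : ℕ, l ≤ v → v ≤ r → ∑ t : D, g t * (if t.1.Mem v then (1 : ℚ) else 0) = 0 := by
      intro v hlv hvr
      by_cases hv : l < v
      · have := congrFun hg ⟨v, Finset.mem_Ioc.2 ⟨hv, hvr⟩⟩
        simpa [vec] using this
      -- The remaining case is v = l, which is not a coordinate but lies in no support; it is needed
      -- when `s` starts at l.
      · refine Finset.sum_eq_zero fun t _ => ?_
        rw [if_neg, mul_zero]
        intro hm
        have := hD t.1 t.2
        have := hm.1
        omega
    have hsD := hD s.1 s.2
    have hslt := s.1.lt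
    have h1 := hx s.1.j (by omega) (by omega)
    have h2 := hx s.1.i (by omega) (by omega)
    -- Subtract the relation at `s.i` from the one at `s.j`. A later strand contains both or neither
    -- of these vertices and cancels, so only the coefficient of `s` survives.
    have h3 : ∑ t : D, (g t * (if t.1.Mem s.1.j then (1 : ℚ) else 0) -
        g t * (if t.1.Mem s.1.i then (1 : ℚ) else 0)) = 0 := by
      rw [Finset.sum_sub_distrib, h1, h2, sub_zero]
    rw [Finset.sum_eq_single s] at h3
    · rw [if_pos s.1.mem_top, if_neg (fun h => lt_irrefl _ h.1), mul_one, mul_zero, sub_zero] at h3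
      exact (Finset.mem_filter.1 hs).2 h3
    · intro t _ hts
      by_cases ht : g t = 0
      · simp [ht]
      · have hle := hmin t (Finset.mem_filter.2 ⟨Finset.mem_univ _, ht⟩)
        obtain ⟨hlt, _⟩ | ⟨_, hp⟩ := h t.1 t.2 s.1 s.2 (fun h => hts (Subtype.ext h))
        · exact absurd hle (not_le.2 hlt)
        · have hp' : t.1.Mem s.1.i ↔ t.1.Mem s.1.j := hp
          simp only [hp', sub_self]
    · exact fun h => absurd (Finset.mem_univ s) h
  have := hli.fintype_card_le_finrank
  simpa using this

open Classical in
/-- A full exceptional set of strands on `{l, …, r}` splits at its longest strand at `l`. -/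
theorem Ordered.exists_split_right {pos : Strand n → ℤ} {D : Finset (Strand n)}
    (h : Ordered pos D) {l r : ℕ} (hlr : l < r) (hD : ∀ s ∈ D, l ≤ s.i ∧ (s.j : ℕ) ≤ r)
    (hcard : r - l ≤ D.card) :
    ∃ X ∈ D, ∃ m : ℕ, (X.i : ℕ) = l ∧ l ≤ m ∧ m < X.j ∧ ∀ s ∈ D, s = X ∨ (s.j : ℕ) ≤ m ∨
      (m + 1 ≤ s.i ∧ s.j ≤ X.j) ∨ X.j ≤ s.i := by
  -- If no strand started at l, all would live on an interval shorter by one, which has room for too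
  -- few.
  have hne : (D.filter fun s => (s.i : ℕ) = l).Nonempty := by
    by_contra hne
    rw [Finset.not_nonempty_iff_eq_empty, Finset.filter_eq_empty_iff] at hne
    have := h.card_le (l := l + 1) (r := r) fun s hs => by
      have := hD s hs; have := hne hs; omega
    omega
  obtain ⟨X, hX, hmax⟩ := Finset.exists_max_image _ (fun s : Strand n => s.j) hne
  obtain ⟨hXD, hXl⟩ := Finset.mem_filter.1 hX
  have hmax' : ∀ s ∈ D, (s.i : ℕ) = l → (s.j : ℕ) ≤ X.j := fun s hs hsl =>
    hmax s (Finset.mem_filter.2 ⟨hs, hsl⟩)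
  have hXlt := X.lt
  -- two strands of `D` do not cross
  have hcross : ∀ s ∈ D, ∀ t ∈ D, ¬ (s.i < t.i ∧ t.i < s.j ∧ s.j < t.j) := by
    intro s hs t ht hst
    have hne : s ≠ t := by rintro rfl; omega
    obtain ⟨_, hp⟩ | ⟨_, hp⟩ := h s hs t ht hne <;> simp only [Prec, Strand.Mem] at hp <;> omega
  -- Some step from m to m + 1 below X is covered by no other strand ending at or before `X.j`.
  -- Otherwise a chain of strands would run from l to `X.j`, closing a cycle with X; the order of
  -- the sequence forbids this.
  have hgap : ∃ m : ℕ, l ≤ m ∧ m < X.j ∧ ∀ s ∈ D, s ≠ X → s.j ≤ X.j →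
      (s.j : ℕ) ≤ m ∨ m + 1 ≤ (s.i : ℕ) := by
    by_contra! hcov
    -- `Q x`: no strand below `X` passes over `x`, and `x` is `l` or the end of a strand after `X`
    let Q : ℕ → Prop := fun x => (∀ s ∈ D, s ≠ X → s.j ≤ X.j → ¬ ((s.i : ℕ) < x ∧ x < s.j)) ∧
      (x = l ∨ ∃ s ∈ D, s ≠ X ∧ (s.j : ℕ) = x ∧ pos X < pos s)
    have hstep : ∀ x : ℕ, l ≤ x → x < X.j → Q x → ∃ y : ℕ, x < y ∧ y ≤ X.j ∧ Q y := by
      intro x hlx hxX hQ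
      obtain ⟨s, hs, hsX, hsj, h1, h2⟩ := hcov x hlx hxX
      have hne : (D.filter fun s => s ≠ X ∧ s.j ≤ X.j ∧ (s.i : ℕ) = x).Nonempty := by
        refine ⟨s, Finset.mem_filter.2 ⟨hs, hsX, hsj, ?_⟩⟩
        have := hQ.1 s hs hsX hsj
        omega
      obtain ⟨Y, hY, hYmax⟩ := Finset.exists_max_image _ (fun s : Strand n => s.j) hne
      obtain ⟨hYD, hYX, hYj, hYi⟩ := Finset.mem_filter.1 hY
      have hYlt := Y.lt
      refine ⟨Y.j, by omega, hYj, ?_, Or.inr ⟨Y, hYD, hYX, rfl, ?_⟩⟩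
      · rintro t ht htX htj ⟨h3, h4⟩
        have h5 := hcross Y hYD t ht
        have h6 := hQ.1 t ht htX htj
        have h7 : t.i = Y.i → t.j ≤ Y.j := fun h =>
          hYmax t (Finset.mem_filter.2 ⟨ht, htX, htj, by omega⟩)
        omega
      -- The first strand of the chain shares its left end with the longer X and so comes after X;
      -- each further one starts where its predecessor ends and so comes after it.
      · obtain rfl | ⟨s, hs, hsX, hsx, hpos⟩ := hQ.2
        · obtain ⟨hlt, _⟩ | ⟨_, hp⟩ := h X hXD Y hYD hYX.symm
          · exact hlt
          · have : Y.j ≠ X.j := fun h => hYX (Strand.ext (by omega) h)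
            simp only [Prec, Strand.Mem] at hp
            omega
        · have hslt := s.lt
          obtain ⟨hlt, _⟩ | ⟨_, hp⟩ := h s hs Y hYD (by rintro rfl; omega)
          · exact hpos.trans hlt
          · simp only [Prec, Strand.Mem] at hp
            omega
    have hQl : Q l := by
      refine ⟨fun s hs _ _ hsl => ?_, Or.inl rfl⟩
      have := hD s hs
      omega
    have hall : ∀ e x : ℕ, l ≤ x → x + e = X.j → Q x → Q X.j := by
      intro e
      induction e using Nat.strong_induction_on with
      | _ e ih =>
        intro x hlx hxe hQ
        by_cases he : e = 0
        · have : x = X.j := by omega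
          exact this ▸ hQ
        · obtain ⟨y, hxy, hyX, hQy⟩ := hstep x hlx (by omega) hQ
          exact ih (X.j - y) (by omega) y (by omega) (by omega) hQy
    obtain ⟨_, hQ⟩ := hall (X.j - l) l le_rfl (by omega) hQl
    obtain hQ | ⟨s, hs, hsX, hsj, hpos⟩ := hQ
    · omega
    -- The last strand of the chain shares its right end with X, which forces it before X, while the
    -- chain places it after X.
    · obtain ⟨_, hp⟩ | ⟨hlt, _⟩ := h X hXD s hs hsX.symm
      · have := hD s hs
        have := s.lt
        simp only [Prec, Strand.Mem] at hp
        omega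
      · exact lt_asymm hlt hpos
  obtain ⟨m, hlm, hmX, hm⟩ := hgap
  refine ⟨X, hXD, m, hXl, hlm, hmX, fun s hs => ?_⟩
  by_cases hsX : s = X
  · exact Or.inl hsX
  · have h1 := hD s hs
    have h2 := hcross X hXD s hs
    have h3 := hmax' s hs
    have h4 := hm s hs hsX
    have h5 := s.lt
    omega

/-- The reflection of a strand. -/
def Strand.refl (s : Strand n) : Strand n := ⟨s.j.rev, s.i.rev, Fin.rev_lt_rev.2 s.lt⟩

theorem Strand.refl_refl (s : Strand n) : s.refl.refl = s := by
  ext <;> simp [Strand.refl]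

theorem Strand.refl_injective : Function.Injective (Strand.refl : Strand n → Strand n) :=
  Function.LeftInverse.injective Strand.refl_refl

/-- The combinatorial shadow of vector space duality, which reverses Hom and Ext and mirrors the
quiver. -/
theorem prec_refl {s t : Strand n} (h : Prec s t) : Prec t.refl s.refl := by
  have := s.lt
  have := t.lt
  simp only [Prec, Strand.Mem, Strand.refl, Fin.val_rev] at h ⊢
  omega

open Classical in
/-- A full exceptional set of strands on `{l, …, r}` splits at its longest strand at `r`. -/
theorem Ordered.exists_split_left {pos : Strand n → ℤ} {D : Finset (Strand n)}
    (h : Ordered pos D) {l r : ℕ} (hlr : l < r) (hr : r ≤ n)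
    (hD : ∀ s ∈ D, l ≤ s.i ∧ (s.j : ℕ) ≤ r) (hcard : r - l ≤ D.card) :
    ∃ X ∈ D, ∃ m : ℕ, (X.j : ℕ) = r ∧ X.i ≤ m ∧ m < r ∧ ∀ s ∈ D, s = X ∨ m + 1 ≤ (s.i : ℕ) ∨
      (X.i ≤ s.i ∧ (s.j : ℕ) ≤ m) ∨ s.j ≤ X.i := by
  -- Reflection reverses the exceptional order, hence the minus sign.
  have h' : Ordered (fun s => - pos s.refl) (D.image Strand.refl) := by
    intro s hs t ht hst
    obtain ⟨s, hs', rfl⟩ := Finset.mem_image.1 hs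
    obtain ⟨t, ht', rfl⟩ := Finset.mem_image.1 ht
    simp only [Strand.refl_refl, neg_lt_neg_iff]
    obtain ⟨h1, h2⟩ | ⟨h1, h2⟩ := h s hs' t ht' (fun h => hst (h ▸ rfl))
    · exact Or.inr ⟨h1, prec_refl h2⟩
    · exact Or.inl ⟨h1, prec_refl h2⟩
  obtain ⟨_, hX', m, h1, h2, h3, h4⟩ := h'.exists_split_right (l := n - r) (r := n - l) (by omega)
    (by
      intro s hs
      obtain ⟨s, hs', rfl⟩ := Finset.mem_image.1 hs
      have := hD s hs'
      simp only [Strand.refl, Fin.val_rev]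
      omega)
    (by rw [Finset.card_image_of_injective _ Strand.refl_injective]; omega)
  obtain ⟨X, hX, rfl⟩ := Finset.mem_image.1 hX'
  have hXb := hD X hX
  simp only [Strand.refl, Fin.val_rev] at h1 h2 h3
  -- Reflection sends the gap between m and m + 1 to the one between n - m - 1 and n - m.
  refine ⟨X, hX, n - m - 1, by omega, by omega, by omega, fun s hs => ?_⟩
  have h5 := h4 s.refl (Finset.mem_image_of_mem _ hs)
  have hsb := hD s hs
  rw [Strand.refl_injective.eq_iff] at h5
  obtain h5 | h5 := h5
  · exact Or.inl h5
  · right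
    simp only [Strand.refl, Fin.val_rev, Fin.rev_le_rev] at h5
    omega

open Classical in
theorem Ordered.card_filter_le {pos : Strand n → ℤ} {D : Finset (Strand n)} (h : Ordered pos D)
    (l r : ℕ) : (D.filter fun s => l ≤ s.i ∧ (s.j : ℕ) ≤ r).card ≤ r - l :=
  (h.mono (Finset.filter_subset _ _)).card_le fun _ hs => (Finset.mem_filter.1 hs).2

-- Each of the three parts has at most the size allowed by linear independence. Together with X they
-- exhaust `D`, so if the total is large enough, every part attains its bound.
open Classical in
theorem Ordered.card_split {pos : Strand n → ℤ} {D : Finset (Strand n)} (h : Ordered pos D)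
    {X : Strand n} {l₁ r₁ l₂ r₂ l₃ r₃ : ℕ} (hD : ∀ s ∈ D, s = X ∨ (l₁ ≤ s.i ∧ (s.j : ℕ) ≤ r₁) ∨
      (l₂ ≤ s.i ∧ (s.j : ℕ) ≤ r₂) ∨ (l₃ ≤ s.i ∧ (s.j : ℕ) ≤ r₃))
    (hcard : 1 + (r₁ - l₁) + (r₂ - l₂) + (r₃ - l₃) ≤ D.card) :
    r₁ - l₁ ≤ (D.filter fun s => l₁ ≤ s.i ∧ (s.j : ℕ) ≤ r₁).card ∧
      r₂ - l₂ ≤ (D.filter fun s => l₂ ≤ s.i ∧ (s.j : ℕ) ≤ r₂).card ∧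
      r₃ - l₃ ≤ (D.filter fun s => l₃ ≤ s.i ∧ (s.j : ℕ) ≤ r₃).card := by
  have hsub : D ⊆ {X} ∪ ((D.filter fun s => l₁ ≤ s.i ∧ (s.j : ℕ) ≤ r₁) ∪
      ((D.filter fun s => l₂ ≤ s.i ∧ (s.j : ℕ) ≤ r₂) ∪
        D.filter fun s => l₃ ≤ s.i ∧ (s.j : ℕ) ≤ r₃)) := by
    intro s hs
    have := hD s hs
    simp only [Finset.mem_union, Finset.mem_singleton, Finset.mem_filter, hs, true_and]
    exact this
  have h1 := (Finset.card_le_card hsub).trans (Finset.card_union_le _ _)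
  have h2 := Finset.card_union_le (D.filter fun s => l₁ ≤ s.i ∧ (s.j : ℕ) ≤ r₁)
    ((D.filter fun s => l₂ ≤ s.i ∧ (s.j : ℕ) ≤ r₂) ∪
      D.filter fun s => l₃ ≤ s.i ∧ (s.j : ℕ) ≤ r₃)
  have h3 := Finset.card_union_le (D.filter fun s => l₂ ≤ s.i ∧ (s.j : ℕ) ≤ r₂)
    (D.filter fun s => l₃ ≤ s.i ∧ (s.j : ℕ) ≤ r₃)
  rw [Finset.card_singleton] at h1
  have b1 := h.card_filter_le l₁ r₁
  have b2 := h.card_filter_le l₂ r₂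
  have b3 := h.card_filter_le l₃ r₃
  omega

open Classical in
/-- Full exceptional sets of strands are the sets of labels of planted trees. -/
theorem Ordered.exists_planted {pos : Strand n → ℤ} (N : ℕ) : ∀ {D : Finset (Strand n)},
    Ordered pos D → ∀ (d : Bool) (l : ℕ), l + N ≤ n → (∀ s ∈ D, l ≤ s.i ∧ (s.j : ℕ) ≤ l + N) →
    N ≤ D.card → ∃ t : TernaryTree (Strand n), Planted d l (l + N) t ∧ ∀ s, s ∈ t.labels ↔ s ∈ D := by
  induction N using Nat.strong_induction_on with
  | _ N ih =>
    intro D h d l hn hD hcard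
    obtain rfl | hN := Nat.eq_zero_or_pos N
    · have := h.card_le hD
      have hD0 : D = ∅ := by
        rw [← Finset.card_eq_zero]; omega
      exact ⟨.leaf, .leaf d l, by simp [hD0, labels, signedLabels]⟩
    -- the planted tree on the strands within a smaller interval
    have ih' : ∀ (d : Bool) (a b : ℕ), a ≤ b → b - a < N → b ≤ n →
        b - a ≤ (D.filter fun s => a ≤ s.i ∧ (s.j : ℕ) ≤ b).card →
        ∃ t : TernaryTree (Strand n), Planted d a b t ∧
          ∀ s, s ∈ t.labels ↔ s ∈ D ∧ a ≤ s.i ∧ (s.j : ℕ) ≤ b := by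
      intro d a b hab hlt hb hc
      obtain ⟨t, ht, hts⟩ := ih (b - a) hlt (h.mono (Finset.filter_subset _ _)) d a (by omega)
        (fun s hs => by have := (Finset.mem_filter.1 hs).2; omega) hc
      rw [Nat.add_sub_cancel' hab] at ht
      exact ⟨t, ht, fun s => (hts s).trans Finset.mem_filter⟩
    cases d with
    | true =>
      obtain ⟨X, hX, m, rfl, hlm, hmX, hsplit⟩ := h.exists_split_right (r := l + N) (by omega) hD
        (by omega)
      have hXb := hD X hX
      obtain ⟨c1, c2, c3⟩ := h.card_split (X := X) (l₁ := X.i) (r₁ := m) (l₂ := m + 1)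
        (r₂ := X.j) (l₃ := X.j) (r₃ := X.i + N)
        (fun s hs => (hsplit s hs).imp_right fun h => by have := hD s hs; omega) (by omega)
      obtain ⟨a, ha, hsa⟩ := ih' true _ _ (by omega) (by omega) (by omega) c1
      obtain ⟨b, hb, hsb⟩ := ih' false _ _ (by omega) (by omega) (by omega) c2
      obtain ⟨c, hc, hsc⟩ := ih' true _ _ (by omega) (by omega) (by omega) c3
      refine ⟨.node X a b c, .right ha hb hc, fun s => ?_⟩
      simp only [labels_node, List.mem_cons, List.mem_append, hsa, hsb, hsc]
      constructor
      · rintro (rfl | h | h | h)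
        exacts [hX, h.1, h.1, h.1]
      · intro hs
        refine (hsplit s hs).imp_right fun h => ?_
        have := hD s hs
        simp only [hs, true_and]
        omega
    | false =>
      obtain ⟨X, hX, m, hXr, hXm, hmr, hsplit⟩ := h.exists_split_left (r := l + N) (by omega) hn hD
        (by omega)
      have hXb := hD X hX
      obtain ⟨c1, c2, c3⟩ := h.card_split (X := X) (l₁ := m + 1) (r₁ := X.j) (l₂ := X.i)
        (r₂ := m) (l₃ := l) (r₃ := X.i)
        (fun s hs => (hsplit s hs).imp_right fun h => by have := hD s hs; omega) (by omega)
      obtain ⟨a, ha, hsa⟩ := ih' false _ _ (by omega) (by omega) (by omega) c1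
      obtain ⟨b, hb, hsb⟩ := ih' true _ _ (by omega) (by omega) (by omega) c2
      obtain ⟨c, hc, hsc⟩ := ih' false _ _ (by omega) (by omega) (by omega) c3
      refine ⟨.node X a b c, hXr ▸ .left ha hb hc, fun s => ?_⟩
      simp only [labels_node, List.mem_cons, List.mem_append, hsa, hsb, hsc]
      constructor
      · rintro (rfl | h | h | h)
        exacts [hX, h.1, h.1, h.1]
      · intro hs
        refine (hsplit s hs).imp_right fun h => ?_
        have := hD s hs
        simp only [hs, true_and]
        omega

end StraightA

/-! ### Propagating perpendicularity through the tree, and passing from sequences to trees -/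

namespace StraightA

open TernaryTree

section Propagation

variable {k : Type u} [Field k] {n : ℕ}

theorem tr_bijective_of_tr {W : QuiverRep k n} {a b c : ℕ} (hab : a ≤ b) (hbc : b ≤ c)
    (h : Function.Bijective (tr W a b hab)) (h' : Function.Bijective (tr W a c (hab.trans hbc))) :
    Function.Bijective (tr W b c hbc) := by
  have : (tr W b c hbc) ∘ (tr W a b hab) = tr W a c (hab.trans hbc) :=
    funext fun x => tr_tr W hab hbc x
  rw [← Function.Bijective.of_comp_iff _ h, this]
  exact h'

/-- The structure map of `W` along every strand of `D` before `s` is bijective. -/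
def PerpBefore (D : Finset (Strand n)) (pos : Strand n → ℤ) (W : QuiverRep k n) (s : Strand n) :
    Prop :=
  ∀ u ∈ D, pos u < pos s → Function.Bijective (tr W u.i u.j u.le)

theorem PerpBefore.mono {D : Finset (Strand n)} {pos : Strand n → ℤ} {W : QuiverRep k n}
    {s t : Strand n} (h : PerpBefore D pos W s) (hts : pos t ≤ pos s) : PerpBefore D pos W t :=
  fun u hu hut => h u hu (hut.trans_le hts)

/-- For representations perpendicular to the strands before `s`, the structure map from `l` to some
vertex beyond `r` is bijective. -/
def HasIsoBeyond (k : Type u) [Field k] (D : Finset (Strand n)) (pos : Strand n → ℤ)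
    (s : Strand n) (l r : ℕ) : Prop :=
  ∃ (z : ℕ) (h : l ≤ z), r ≤ z ∧
    ∀ W : QuiverRep k n, PerpBefore D pos W s → Function.Bijective (tr W l z h)

/-- Some `M_{y,r}` with `y < l` is perpendicular to the strands before `s`. -/
def HasLongerPerp (D : Finset (Strand n)) (pos : Strand n → ℤ) (s : Strand n) (l r : ℕ) : Prop :=
  ∃ y : ℕ, y < l ∧ ∀ u ∈ D, pos u < pos s →
    ((y < u.i ∧ (u.i : ℕ) ≤ r) ↔ (y < u.j ∧ (u.j : ℕ) ≤ r))

theorem Ordered.pos_lt {pos : Strand n → ℤ} {D : Finset (Strand n)} (h : Ordered pos D)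
    {s t : Strand n} (hs : s ∈ D) (ht : t ∈ D) (hne : s ≠ t) (hp : ¬ Prec t s) : pos s < pos t := by
  obtain ⟨h1, _⟩ | ⟨_, h2⟩ := h s hs t ht hne
  · exact h1
  · exact absurd h2 hp

theorem Ordered.prec {pos : Strand n → ℤ} {D : Finset (Strand n)} (h : Ordered pos D)
    {s t : Strand n} (hs : s ∈ D) (ht : t ∈ D) (hlt : pos s < pos t) : Prec s t := by
  obtain ⟨_, h2⟩ | ⟨h1, _⟩ := h s hs t ht (by rintro rfl; exact lt_irrefl _ hlt)
  · exact h2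
  · exact absurd h1 (lt_asymm hlt)

/-- The induction carries the property only for strands at the root vertex of the current subtree,
relative to its whole interval. It then passes to each child because strands meeting at an endpoint
of X have a forced order relative to X. -/
theorem Planted.perp_of_sign {D : Finset (Strand n)} {pos : Strand n → ℤ} (hord : Ordered pos D)
    {d : Bool} {l r : ℕ} {t : TernaryTree (Strand n)} (h : Planted d l r t)
    (hsub : ∀ s ∈ t.labels, s ∈ D)
    (hroot : ∀ s ∈ t.labels, if d then (s.i : ℕ) = l → HasIsoBeyond k D pos s l r
      else (s.j : ℕ) = r → HasLongerPerp D pos s l r) :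
    ∀ p ∈ t.signedLabels d, if p.2 then HasIsoBeyond k D pos p.1 p.1.i p.1.j
      else HasLongerPerp D pos p.1 p.1.i p.1.j := by
  induction h with
  | leaf d l => simp [signedLabels]
  | @right m r X a b c ha hb hc iha ihb ihc =>
    have := ha.le; have := hb.le; have := hc.le
    have ba := ha.bounds; have bb := hb.bounds; have bc := hc.bounds
    simp only [labels_node, List.mem_cons, List.mem_append] at hsub hroot
    simp only [if_true, Bool.false_eq_true, if_false] at hroot iha ihb ihc
    have hXD := hsub X (Or.inl rfl)
    have hX := hroot X (Or.inl rfl) rfl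
    intro p hp
    simp only [signedLabels, List.mem_cons, List.mem_append, Bool.not_true] at hp
    obtain rfl | hp | hp | hp := hp
    · obtain ⟨z, hlz, hrz, hz⟩ := hX
      exact ⟨z, hlz, by dsimp only; omega, hz⟩
    · refine iha (fun s hs => hsub s (Or.inr (Or.inl hs))) (fun s hs hsl => ?_) p hp
      obtain ⟨z, hlz, hrz, hz⟩ := hroot s (Or.inr (Or.inl hs)) hsl
      exact ⟨z, hlz, by omega, hz⟩
    · refine ihb (fun s hs => hsub s (Or.inr (Or.inr (Or.inl hs)))) (fun s hs hsr => ?_) p hp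
      have hsD := hsub s (Or.inr (Or.inr (Or.inl hs)))
      have hsb := bb s hs
      have hslt := s.lt
      -- The longer module is `M_X` itself: it ends at the same vertex, and since `s` comes before
      -- X, so do all strands before `s`.
      refine ⟨X.i, by omega, fun u hu hus => ?_⟩
      have hsX : pos s < pos X := hord.pos_lt hsD hXD (by rintro rfl; omega) (by
        simp only [Prec, Strand.Mem]; omega)
      exact hord.prec hu hXD (hus.trans hsX)
    · refine ihc (fun s hs => hsub s (Or.inr (Or.inr (Or.inr hs)))) (fun s hs hsl => ?_) p hp
      have hsD := hsub s (Or.inr (Or.inr (Or.inr hs)))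
      have hsb := bc s hs
      have hslt := s.lt
      have hXlt := X.lt
      have hXs : pos X < pos s := hord.pos_lt hXD hsD (by rintro rfl; omega) (by
        simp only [Prec, Strand.Mem]; omega)
      obtain ⟨z, hlz, hrz, hz⟩ := hX
      -- X comes before `s`, so its structure map is bijective on W; cancel it from the bijection
      -- starting at `X.i`.
      exact ⟨z, by omega, hrz, fun W hW =>
        tr_bijective_of_tr X.le (by omega) (hW X hXD hXs) (hz W (hW.mono hXs.le))⟩
  | @left l m X a b c ha hb hc iha ihb ihc =>
    have := ha.le; have := hb.le; have := hc.le
    have ba := ha.bounds; have bb := hb.bounds; have bc := hc.bounds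
    simp only [labels_node, List.mem_cons, List.mem_append] at hsub hroot
    simp only [if_true, Bool.false_eq_true, if_false] at hroot iha ihb ihc
    have hXD := hsub X (Or.inl rfl)
    have hX := hroot X (Or.inl rfl) rfl
    intro p hp
    simp only [signedLabels, List.mem_cons, List.mem_append, Bool.not_false] at hp
    obtain rfl | hp | hp | hp := hp
    · obtain ⟨y, hy, hyu⟩ := hX
      exact ⟨y, by dsimp only; omega, hyu⟩
    · refine iha (fun s hs => hsub s (Or.inr (Or.inl hs))) (fun s hs hsr => ?_) p hp
      -- The subtree a still ends at the old root vertex, and its left end only moves to the right,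
      -- so the same y works.
      obtain ⟨y, hy, hyu⟩ := hroot s (Or.inr (Or.inl hs)) hsr
      exact ⟨y, by omega, hyu⟩
    · refine ihb (fun s hs => hsub s (Or.inr (Or.inr (Or.inl hs)))) (fun s hs hsl => ?_) p hp
      have hsD := hsub s (Or.inr (Or.inr (Or.inl hs)))
      have hsb := bb s hs
      have hslt := s.lt
      have hXlt := X.lt
      have hXs : pos X < pos s := hord.pos_lt hXD hsD (by rintro rfl; omega) (by
        simp only [Prec, Strand.Mem]; omega)
      -- X comes before `s`, so its own structure map is a bijection reaching past the interval of
      -- b.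
      exact ⟨X.j, X.le, by omega, fun W hW => hW X hXD hXs⟩
    · refine ihc (fun s hs => hsub s (Or.inr (Or.inr (Or.inr hs)))) (fun s hs hsr => ?_) p hp
      have hsD := hsub s (Or.inr (Or.inr (Or.inr hs)))
      have hsb := bc s hs
      have hslt := s.lt
      have hXlt := X.lt
      have hsX : pos s < pos X := hord.pos_lt hsD hXD (by rintro rfl; omega) (by
        simp only [Prec, Strand.Mem]; omega)
      obtain ⟨y, hy, hyu⟩ := hX
      -- The module with support (y, X.i] is the quotient of the longer module (y, X.j] by `M_X`.
      -- Both are perpendicular to `u`, hence so is the quotient.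
      refine ⟨y, hy, fun u hu hus => ?_⟩
      have h1 := hyu u hu (hus.trans hsX)
      have h2 := hord.prec hu hXD (hus.trans hsX)
      simp only [Prec, Strand.Mem] at h2
      omega

end Propagation

/-! ### Exceptional sequences and sequences of strands -/

section Sequences

variable {k : Type u} [Field k] {n : ℕ}

theorem IsExceptionalSequence.exists_strands {V : Fin n → QuiverRep k n}
    (h : IsExceptionalSequence V) : ∃ σ : Fin n → Strand n,
      (∀ i, Nonempty (V i ≅ intervalModule k (σ i))) ∧ ∀ i j, j < i → Prec (σ j) (σ i) := by
  choose σ e using fun i => exists_iso_intervalModule (h.exceptional i)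
  refine ⟨σ, e, fun i j hij => ?_⟩
  rw [← homExtVanish_interval_iff (k := k)]
  exact (h.vanish i j hij).of_iso (e i).some (e j).some

theorem isExceptionalSequence_interval {σ : Fin n → Strand n}
    (h : ∀ i j, j < i → Prec (σ j) (σ i)) :
    IsExceptionalSequence fun i => intervalModule k (σ i) where
  exceptional _ := isExceptional_intervalModule _
  vanish i j hij := (homExtVanish_interval_iff _ _).2 (h i j hij)

theorem injective_of_prec {σ : Fin n → Strand n} (h : ∀ i j, j < i → Prec (σ j) (σ i)) :
    Function.Injective σ := by
  intro i j hij
  by_contra hne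
  obtain hlt | hlt := lt_or_gt_of_ne hne
  · exact Planted.not_prec_self _ (hij ▸ h j i hlt)
  · exact Planted.not_prec_self _ (hij ▸ h i j hlt)

open Classical in
theorem exists_pos {σ : Fin n → Strand n} (h : ∀ i j, j < i → Prec (σ j) (σ i)) :
    ∃ pos : Strand n → ℤ, (∀ i, pos (σ i) = (i : ℕ)) ∧ Ordered pos (Finset.univ.image σ) := by
  have hinj := injective_of_prec h
  -- The value 0 off the range of σ is a dummy; only positions of strands of the sequence are
  -- compared.
  refine ⟨Function.extend σ (fun i => ((i : ℕ) : ℤ)) 0, fun i => hinj.extend_apply _ _ _, ?_⟩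
  intro s hs t ht hst
  obtain ⟨i, _, rfl⟩ := Finset.mem_image.1 hs
  obtain ⟨j, _, rfl⟩ := Finset.mem_image.1 ht
  rw [hinj.extend_apply, hinj.extend_apply]
  obtain hlt | hlt := lt_or_gt_of_ne (fun hij => hst (congrArg σ hij) : i ≠ j)
  · exact Or.inl ⟨by exact_mod_cast hlt, h j i hlt⟩
  · exact Or.inr ⟨by exact_mod_cast hlt, h i j hlt⟩

theorem range_isoClass {V : Fin n → QuiverRep k n} {σ : Fin n → Strand n}
    (e : ∀ i, Nonempty (V i ≅ intervalModule k (σ i))) :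
    (Set.range fun i => isoClass (V i)) = moduleClass k '' Set.range σ := by
  rw [← Set.range_comp]
  exact congrArg Set.range (funext fun i => isoClass_eq_iff.2 (e i))

theorem strands_image (D : Set (Strand n)) : strands (moduleClass k '' D) = D :=
  Set.ext fun _ => moduleClass_injective.mem_set_image

open Classical in
/-- The tree of an exceptional sequence of strands. -/
theorem exists_planted_of_prec {σ : Fin n → Strand n} (h : ∀ i j, j < i → Prec (σ j) (σ i)) :
    ∃ t : TernaryTree (Strand n), Planted true 0 n t ∧ ∀ s, s ∈ t.labels ↔ s ∈ Set.range σ := by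
  obtain ⟨pos, _, hord⟩ := exists_pos h
  obtain ⟨t, ht, hts⟩ := hord.exists_planted n true 0 (by omega) (fun s _ => by omega) (by
    rw [Finset.card_image_of_injective _ (injective_of_prec h), Finset.card_univ, Fintype.card_fin])
  rw [Nat.zero_add] at ht
  exact ⟨t, ht, fun s => by rw [hts]; simp⟩

/-- The labels of a planted tree form an exceptional sequence in some order. -/
theorem Planted.exists_sequence {t : TernaryTree (Strand n)} (ht : Planted true 0 n t) :
    ∃ σ : Fin n → Strand n, (∀ i j, j < i → Prec (σ j) (σ i)) ∧
      Set.range σ = {s | s ∈ t.labels} := by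
  obtain ⟨L, hL, hP⟩ := ht.exists_ordering
  have hlen : L.length = n := by
    have := ht.add_numNodes
    rw [hL.length_eq, length_labels]
    omega
  refine ⟨fun i => L.get (i.cast hlen.symm), fun i j hij => ?_, ?_⟩
  · exact List.pairwise_iff_get.1 hP _ _ hij
  · ext s
    simp only [Set.mem_range, ← hL.mem_iff, List.mem_iff_get]
    constructor
    · rintro ⟨i, rfl⟩
      exact ⟨_, rfl⟩
    · rintro ⟨i, rfl⟩
      exact ⟨i.cast hlen, rfl⟩

end Sequences

end StraightA

/-! ### The bijections and the parity criterion for exceptional collections -/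

namespace StraightA

open TernaryTree

section Main

variable {k : Type u} [Field k] {n : ℕ}

theorem isRelativelyInjective_iff {V : Fin n → QuiverRep k n} (hV : IsExceptionalSequence V)
    {σ : Fin n → Strand n} (e : ∀ i, V i ≅ intervalModule k (σ i))
    (hσ : ∀ i j, j < i → Prec (σ j) (σ i)) {t : TernaryTree (Strand n)} (ht : Planted true 0 n t)
    (hts : ∀ s, s ∈ t.labels ↔ s ∈ Set.range σ) (i : Fin n) (sign : Bool)
    (hi : (σ i, sign) ∈ t.signedLabels true) : IsRelativelyInjective V i ↔ sign = true := by
  classical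
  obtain ⟨pos, hpos, hord⟩ := exists_pos hσ
  have hperp := ht.perp_of_sign (k := k) hord (fun s hs => by simpa using (hts s).1 hs)
    (fun s _ => by
      rw [if_pos rfl]
      -- At the root of the whole tree the interval is {0, …, n}, and the map from vertex 0 to
      -- vertex n + 1 joins zero spaces.
      exact fun _ => ⟨n + 1, by omega, by omega, fun W _ =>
        tr_zero_top_bijective W rfl n.lt_succ_self⟩) _ hi
  cases sign with
  | true =>
    refine iff_of_true ?_ rfl
    obtain ⟨z, h, hz, hW⟩ : HasIsoBeyond k _ pos (σ i) (σ i).i (σ i).j := hperp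
    refine isRelativelyInjective_of_bijective e i (fun j hj => hV.vanish i j hj) hz fun W hW' => ?_
    refine hW W fun u hu hui => ?_
    obtain ⟨j, _, rfl⟩ := Finset.mem_image.1 hu
    rw [hpos, hpos] at hui
    exact (leftPerp_iff e i W).1 hW' j (by exact_mod_cast hui)
  | false =>
    refine iff_of_false ?_ (by simp)
    obtain ⟨y, hy, hyu⟩ : HasLongerPerp _ pos (σ i) (σ i).i (σ i).j := hperp
    refine not_isRelativelyInjective e i ⟨y, by omega⟩ hy ((leftPerp_iff e i _).2 fun j hj => ?_)
    rw [tr_interval_bijective]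
    exact hyu (σ j) (Finset.mem_image_of_mem _ (Finset.mem_univ _)) (by
      rw [hpos, hpos]
      exact_mod_cast hj)

theorem ExceptionalCollection.exists_tree (E : ExceptionalCollection k n) :
    ∃ t : TernaryTree (Strand n), Planted true 0 n t ∧ (∀ s, s ∈ t.labels ↔ s ∈ strands E.1) ∧
      E.1 = moduleClass k '' {s | s ∈ t.labels} := by
  obtain ⟨E, V, hV, rfl⟩ := E
  obtain ⟨σ, e, hσ⟩ := hV.exists_strands
  obtain ⟨t, ht, hts⟩ := exists_planted_of_prec hσ
  have hset : {s | s ∈ t.labels} = Set.range σ := Set.ext hts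
  refine ⟨t, ht, fun s => ?_, ?_⟩
  · dsimp only
    rw [hts, range_isoClass e, strands_image]
  · rw [hset]
    exact range_isoClass e

/-- The labelled ternary tree of an exceptional collection. -/
noncomputable def ExceptionalCollection.tree (E : ExceptionalCollection k n) :
    TernaryTree (Strand n) := E.exists_tree.choose

namespace ExceptionalCollection

theorem planted_tree (E : ExceptionalCollection k n) : Planted true 0 n E.tree :=
  E.exists_tree.choose_spec.1

theorem mem_labels_tree (E : ExceptionalCollection k n) (s : Strand n) :
    s ∈ E.tree.labels ↔ s ∈ strands E.1 :=
  E.exists_tree.choose_spec.2.1 s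

theorem eq_image (E : ExceptionalCollection k n) :
    E.1 = moduleClass k '' {s | s ∈ E.tree.labels} :=
  E.exists_tree.choose_spec.2.2

theorem numNodes_tree (E : ExceptionalCollection k n) : E.tree.numNodes = n := by
  have := E.planted_tree.add_numNodes
  omega

theorem isTreeOf_tree (E : ExceptionalCollection k n) : E.tree.IsTreeOf (strands E.1) := by
  have := E.planted_tree.isTreeOf
  have h : {s | s ∈ E.tree.labels} = strands E.1 := Set.ext E.mem_labels_tree
  rwa [h] at this

theorem isTreeOf_iff (E : ExceptionalCollection k n) (t : TernaryTree (Strand n)) :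
    t.IsTreeOf (strands E.1) ↔ t = E.tree :=
  ⟨fun h => isGrownFrom_unique h E.isTreeOf_tree, fun h => h ▸ E.isTreeOf_tree⟩

theorem shape_injective :
    Function.Injective fun E : ExceptionalCollection k n => E.tree.shape := by
  intro E E' h
  have h1 : E.tree = E'.tree := E.planted_tree.eq_of_shape E'.planted_tree rfl h
  apply Subtype.ext
  rw [E.eq_image, E'.eq_image, h1]

theorem exists_of_shape (s : TernaryTree Unit) (hs : s.numNodes = n) :
    ∃ E : ExceptionalCollection k n, E.tree.shape = s := by
  obtain ⟨t, ht, rfl⟩ := Planted.exists_of_shape (n := n) s true 0 (by omega)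
  rw [Nat.zero_add, hs] at ht
  obtain ⟨σ, hσ, hr⟩ := ht.exists_sequence
  let E : ExceptionalCollection k n := ⟨moduleClass k '' {s | s ∈ t.labels},
    fun i => intervalModule k (σ i), isExceptionalSequence_interval hσ, by
      rw [← hr]
      exact (range_isoClass fun i => ⟨Iso.refl _⟩).symm⟩
  refine ⟨E, ?_⟩
  have h1 : t.IsTreeOf (strands E.1) := by
    have := ht.isTreeOf
    rwa [← strands_image (k := k) {s | s ∈ t.labels}] at this
  -- `E.tree` was chosen without reference to `t`; uniqueness of the tree grown from the diagram
  -- identifies the two.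
  rw [(E.isTreeOf_iff t).1 h1]

/-- The lattice path of an exceptional collection. -/
noncomputable def path (E : ExceptionalCollection k n) : LatticePath n :=
  ⟨E.tree.vertices.map fun v => stepOf v.2, by
    have := isLatticePath_word E.tree
    rwa [E.numNodes_tree] at this⟩

theorem path_bijective :
    Function.Bijective (path : ExceptionalCollection k n → LatticePath n) := by
  constructor
  · intro E E' h
    apply shape_injective
    apply word_injective
    dsimp only
    rw [word_shape, word_shape]
    exact congrArg Subtype.val h
  · rintro ⟨p, hp⟩
    obtain ⟨t, ht, rfl⟩ := exists_word_eq hp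
    obtain ⟨E, rfl⟩ := exists_of_shape (k := k) t ht
    exact ⟨E, Subtype.ext (word_shape _).symm⟩

theorem exists_label (E : ExceptionalCollection k n) (e : VerticalEdge E.path.1) :
    ∃ s : Strand n, E.tree.opts[e.1]? = some (some s) := by
  obtain ⟨m, hm⟩ := e
  have h1 : (E.tree.opts.map stepOf)[m]? = some Step.up := by
    rw [← word_eq]
    exact hm
  rw [List.getElem?_map, Option.map_eq_some_iff] at h1
  obtain ⟨o, ho, hs⟩ := h1
  cases o with
  | none => cases hs
  | some s => exact ⟨s, ho⟩

/-- The label of the node of a vertical edge. -/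
noncomputable def edgeLabel (E : ExceptionalCollection k n) (e : VerticalEdge E.path.1) :
    Strand n := (E.exists_label e).choose

theorem opts_edgeLabel (E : ExceptionalCollection k n) (e : VerticalEdge E.path.1) :
    E.tree.opts[e.1]? = some (some (E.edgeLabel e)) := (E.exists_label e).choose_spec

theorem mem_labels_edgeLabel (E : ExceptionalCollection k n) (e : VerticalEdge E.path.1) :
    E.edgeLabel e ∈ E.tree.labels := by
  rw [labels_eq_filterMap, List.mem_filterMap]
  exact ⟨_, List.mem_of_getElem? (E.opts_edgeLabel e), rfl⟩

/-- No strand labels two nodes, since `Prec` is irreflexive and the labels can be ordered by it. -/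
theorem edgeLabel_injective (E : ExceptionalCollection k n) :
    Function.Injective E.edgeLabel := by
  intro e e' h
  have hnd := E.planted_tree.nodup_labels
  rw [labels_eq_filterMap, List.Nodup, List.pairwise_filterMap, List.pairwise_iff_getElem] at hnd
  obtain ⟨h1, h1'⟩ := List.getElem?_eq_some_iff.1 (E.opts_edgeLabel e)
  obtain ⟨h2, h2'⟩ := List.getElem?_eq_some_iff.1 (E.opts_edgeLabel e')
  apply Subtype.ext
  by_contra hne
  obtain hlt | hlt := lt_or_gt_of_ne hne
  · exact hnd _ _ h1 h2 hlt _ h1' _ h2' h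
  · exact hnd _ _ h2 h1 hlt _ h2' _ h1' h.symm

/-- The object of an exceptional collection given by a vertical edge of its path. -/
noncomputable def edgeObject (E : ExceptionalCollection k n) (e : VerticalEdge E.path.1) :
    {x : IsoClass k n // x ∈ E.1} :=
  ⟨moduleClass k (E.edgeLabel e), (E.mem_labels_tree _).1 (E.mem_labels_edgeLabel e)⟩

theorem edgeObject_bijective (E : ExceptionalCollection k n) :
    Function.Bijective E.edgeObject := by
  constructor
  · intro e e' h
    exact E.edgeLabel_injective (moduleClass_injective (congrArg Subtype.val h))
  · rintro ⟨x, hx⟩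
    have hx' := hx
    rw [E.eq_image] at hx'
    obtain ⟨s, hs, rfl⟩ := hx'
    have hs' : s ∈ E.tree.labels := hs
    rw [labels_eq_filterMap, List.mem_filterMap] at hs'
    obtain ⟨o, ho, rfl⟩ := hs'
    obtain ⟨m, hm⟩ := List.mem_iff_getElem?.1 ho
    have hup : E.path.1[m]? = some Step.up := by
      change E.tree.word[m]? = _
      rw [word_eq, List.getElem?_map, hm]
      rfl
    refine ⟨⟨m, hup⟩, Subtype.ext (congrArg (moduleClass k) ?_)⟩
    have := E.opts_edgeLabel ⟨m, hup⟩
    rw [hm] at this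
    exact (Option.some.inj (Option.some.inj this)).symm

theorem firstCoord_eq (E : ExceptionalCollection k n) (e : VerticalEdge E.path.1) :
    e.firstCoord = (E.tree.opts.take e.1).countP Option.isNone := by
  change (E.tree.word.take e.1).count Step.right = _
  rw [word_eq, ← List.map_take, List.count, List.countP_map]
  refine List.countP_congr fun o _ => ?_
  cases o <;> simp [stepOf]

/-- The first coordinate counts the leaves before the node. Its parity is the sign of the node,
which depends on the tree alone, so the criterion is the same for every ordering. -/
theorem isRelativelyInjective_edge_iff (E : ExceptionalCollection k n)
    {V : Fin n → QuiverRep k n} (hV : IsOrderingOf V E.1) (i : Fin n)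
    (e : VerticalEdge E.path.1) (he : (E.edgeObject e).1 = isoClass (V i)) :
    IsRelativelyInjective V i ↔ Even e.firstCoord := by
  obtain ⟨σ, iso, hσ⟩ := hV.1.exists_strands
  have hr : strands E.1 = Set.range σ := by
    rw [hV.2, range_isoClass iso, strands_image]
  have hs : E.edgeLabel e = σ i :=
    moduleClass_injective (he.trans (isoClass_eq_iff.2 (iso i)))
  have hsign := mem_leafParities true _ _ _ (E.opts_edgeLabel e)
  rw [leafParities_opts, hs] at hsign
  rw [isRelativelyInjective_iff hV.1 (fun i => (iso i).some) hσ E.planted_tree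
    (fun s => by rw [E.mem_labels_tree, hr]) i _ hsign, E.firstCoord_eq]
  simp

end ExceptionalCollection

end Main

end StraightA

theorem mainTheorem7 (k : Type u) [Field k] (n : ℕ) :
    ∃ (T : ExceptionalCollection k n → TernaryTree (Strand n))
      (Φ : ExceptionalCollection k n ≃ LatticePath n)
      (obj : ∀ E : ExceptionalCollection k n,
        VerticalEdge (Φ E).1 ≃ {x : IsoClass k n // x ∈ E.1}),
      -- `T E` is the labelled ternary tree of `E`, which exists and is unique
      (∀ E t, t.IsTreeOf (strands E.1) ↔ t = T E) ∧
      -- collections correspond to ternary trees with `n` nodes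
      Set.BijOn (fun E => (T E).shape) Set.univ {t | t.numNodes = n} ∧
      ∀ E : ExceptionalCollection k n,
        -- the tree has `2n + 1` leaves
        (T E).numLeaves = 2 * n + 1 ∧
        -- the vertices of the tree are listed in lexicographic order of their addresses
        ((T E).vertices.map Prod.fst).Pairwise (· < ·) ∧
        -- the edges of the path are the vertices of the tree in this order
        (Φ E).1 = (T E).vertices.map (fun v => stepOf v.2) ∧
        -- the vertical edge given by a node corresponds to the object that labels the node
        (∀ (e : VerticalEdge (Φ E).1) (w : List (Fin 3)) (s : Strand n),
          (T E).vertices[e.1]? = some (w, some s) →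
            (obj E e).1 = moduleClass k s) ∧
        -- relatively injective objects are the vertical edges with even first coordinate
        (∀ V : Fin n → QuiverRep k n, IsOrderingOf V E.1 →
          ∀ (i : Fin n) (e : VerticalEdge (Φ E).1),
            (obj E e).1 = isoClass (V i) →
              (IsRelativelyInjective V i ↔ Even e.firstCoord)) := by
  refine ⟨ExceptionalCollection.tree,
    Equiv.ofBijective ExceptionalCollection.path ExceptionalCollection.path_bijective,
    fun E => Equiv.ofBijective E.edgeObject E.edgeObject_bijective,
    fun E t => E.isTreeOf_iff t, ⟨?_, ?_, ?_⟩, fun E => ⟨?_, ?_, rfl, ?_, ?_⟩⟩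
  · intro E _
    exact (TernaryTree.numNodes_shape _).trans E.numNodes_tree
  · exact ExceptionalCollection.shape_injective.injOn
  · intro t ht
    obtain ⟨E, hE⟩ := ExceptionalCollection.exists_of_shape (k := k) t ht
    exact ⟨E, trivial, hE⟩
  · rw [TernaryTree.numLeaves_eq, E.numNodes_tree]
  · exact TernaryTree.pairwise_vertices _
  · intro e w s h
    refine congrArg (moduleClass k) ?_
    have h1 := E.opts_edgeLabel e
    rw [TernaryTree.opts, List.getElem?_map] at h1
    erw [h] at h1
    exact (Option.some.inj (Option.some.inj h1)).symm
  · exact fun V hV i e he => E.isRelativelyInjective_edge_iff hV i e he
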